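/- **Corollary** ($\mathrm{BNAL}[\mathrm{poly}(n)]=\mathrm{NP}$). Let $\Sigma$ be a finite alphabet. The languages $L\subseteq\Sigma^*$ that are accepted in polynomially many steps by nondeterministic automatic register machines using bounded automatic relations are exactly the languages in $\mathrm{NP}$: $$\bigcup_{k\in\mathbb N}\mathrm{BNAL}[n^k]=\mathrm{NP}=\bigcup_{k\in\mathbb N}\mathrm{NTIME}[n^k].$$ Here the notions are as follows. The *convolution* of finitely many strings over a finite alphabet $\Gamma$ is the string of tuples whose $i$-th letter is the tuple of the $i$-th letters of the strings, shorter strings being padded at the end with a new symbol $\#$; its length is the maximum of the lengths of the strings. A relation between strings is *automatic* if the set of the convolutions of its tuples is a regular language. An automatic relation $F(x_1,\dots,x_k;y)$ between parameters $x_1,\dots,x_k$ and a result $y$ is *bounded* if there is a constant $c$ such that $\bigl|\,|y|-\max_i|x_i|\,\bigr|\le c$ whenever $F(x_1,\dots,x_k;y)$ holds. A *nondeterministic automatic register machine* has a finite alphabet $\Gamma\supseteq\Sigma$, finitely many registers that hold strings over $\Gamma$ (initially empty), finitely many operations, and a finite list of numbered instructions of the forms: $\mathit{read}(R_i)$ (the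 input string is assigned to $R_i$); $\mathit{write}(R_i)$; $R_i\leftarrow w$ with $w\in\Sigma^*$; $R_i\leftarrow R_j$; $R_i\leftarrow F(R_{j_1},\dots,R_{j_k})$, where $F$ is a bounded automatic relation and $R_i$ nondeterministically receives some $y$ with $F(R_{j_1},\dots,R_{j_k};y)$ (if there is none, the path ends without accepting); $\mathit{goto}(l)$; $\mathit{if}\ F(R_{j_1},\dots,R_{j_k})\ \mathit{then\ goto}(l)$ with an automatic relation $F$; $\mathit{halt}$, $\mathit{halt\_accept}$, $\mathit{halt\_reject}$. The instructions are performed in order, starting from the first, except for jumps, and performing one instruction is one step. A string is accepted if at least one computation path on it reaches $\mathit{halt\_accept}$. $\mathrm{BNAL}[f(n)]$ is the class of languages $L\subseteq\Sigma^*$ for which there is such a machine that accepts exactly the strings of $L$ and all of whose accepting paths on inputs of length $n$ take at most $O(f(n))$ steps. $\mathrm{NTIME}[f(n)]$ is the class of languages $L\subseteq\Sigma^*$ for which there is a nondeterministic one-tape Turing machine that accepts exactly the strings of $L$ (on at least one path) and all of whose computation paths on inputs of length $n$ end after at most $O(f(n))$ steps. -/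

import Mathlib

open Filter Asymptotics

namespace AutReg

/-- `StepsTo r n a b`: there is a path `a = c₀, c₁, …, cₙ = b` with `r cᵢ cᵢ₊₁` for all `i < n`. -/
inductive StepsTo {α : Type*} (r : α → α → Prop) : ℕ → α → α → Prop
  | zero (a : α) : StepsTo r 0 a a
  | succ {n : ℕ} {a b c : α} : StepsTo r n a b → r b c → StepsTo r (n + 1) a c

/-! ### Automatic relations -/

section Automatic

variable {ι Γ : Type} [Fintype ι]

/-- The length of the longest of finitely many strings (`0` if there are none); this is the length
of their convolution. -/
def maxLen (w : ι → List Γ) : ℕ := Finset.univ.sup fun j => (w j).length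

/-- The convolution of finitely many strings: its `i`-th letter is the tuple of the `i`-th letters
of the strings, where `none` is the padding symbol `#` put behind the end of the shorter ones. -/
def conv (w : ι → List Γ) : List (ι → Option Γ) :=
  (List.range (maxLen w)).map fun i j => (w j)[i]?

/-- A relation between finitely many strings is automatic if the set of the convolutions of its
tuples is a regular language. -/
def IsAutomatic (S : Set (ι → List Γ)) : Prop :=
  Language.IsRegular (conv '' S : Set (List (ι → Option Γ)))

/-- A relation between parameters `x` and a result `y`, as one relation on the tuples that consist
of the parameters (indices `some i`) and the result (index `none`). -/
def graph (F : (ι → List Γ) → List Γ → Prop) : Set (Option ι → List Γ) :=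
  {z | F (fun i => z (some i)) (z none)}

/-- `F` is bounded: the length of a result differs from the length of the convolution of the
parameters by at most a constant. -/
def IsBounded (F : (ι → List Γ) → List Γ → Prop) : Prop :=
  ∃ c : ℕ, ∀ x y, F x y → y.length ≤ maxLen x + c ∧ maxLen x ≤ y.length + c

end Automatic

/-! ### Automatic register machines -/

/-- The instructions of an automatic register machine with input alphabet `A`, registers `R`,
string-valued operations `Op`, and truth-valued operations `Test`. Lines are numbered from `0`. -/
inductive Instr (A : Type*) (R Op Test : Type) (arity : Op → ℕ) (testArity : Test → ℕ)
  /-- `read(i)` -/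
  | read (i : R)
  /-- `write(i)` -/
  | write (i : R)
  /-- `i ← w` -/
  | const (i : R) (w : List A)
  /-- `i ← j` -/
  | copy (i j : R)
  /-- `i ← F(p₁, …, pₖ)` -/
  | apply (i : R) (F : Op) (p : Fin (arity F) → R)
  /-- `goto(l)` -/
  | goto (l : ℕ)
  /-- `if F(p₁, …, pₖ) then goto(l)` -/
  | ifGoto (F : Test) (p : Fin (testArity F) → R) (l : ℕ)
  | halt
  | haltAccept
  | haltReject

/-- An automatic register machine with input alphabet `A`: a finite machine alphabet `Γ` that
contains `A`, finitely many registers, finitely many operations, all of them automatic relations,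
and a program. An operation that is used in an assignment relates its parameters to the possible
results; an operation that is used in a conditional jump is true of its parameters or not. -/
structure ARM (A : Type*) where
  /-- the machine alphabet -/
  Γ : Type
  finiteΓ : Finite Γ
  /-- the inclusion of the input alphabet in the machine alphabet -/
  incl : A ↪ Γ
  /-- the number of registers -/
  numReg : ℕ
  /-- names of the operations with strings as results -/
  Op : Type
  finiteOp : Finite Op
  arity : Op → ℕ
  /-- `op F x y`: the string `y` is a possible result of `F` with parameters `x` -/
  op : (F : Op) → (Fin (arity F) → List Γ) → List Γ → Prop
  op_automatic : ∀ F, IsAutomatic (graph (op F))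
  /-- names of the operations with truth values as results -/
  Test : Type
  finiteTest : Finite Test
  testArity : Test → ℕ
  /-- the tuples of parameters of which `F` is true -/
  test : (F : Test) → Set (Fin (testArity F) → List Γ)
  test_automatic : ∀ F, IsAutomatic (test F)
  program : List (Instr A (Fin numReg) Op Test arity testArity)

namespace ARM

variable {A : Type*} (M : ARM A)

/-- A configuration: the number of the line to be performed next, and the contents of the
registers. -/
structure Cfg where
  line : ℕ
  reg : Fin M.numReg → List M.Γ

/-- Initially the first line is to be performed and all registers are empty. -/
def init : M.Cfg := ⟨0, fun _ => []⟩

/-- The configurations that can result from `c` when the instruction is performed on input `x`.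
There is none after a halt instruction, nor after an assignment `i ← F(p)` if `F` relates its
parameters to no string. What is written is not recorded, as it plays no role for recognition by
`halt_accept`. -/
def Perform (x : List A) (c : M.Cfg) :
    Instr A (Fin M.numReg) M.Op M.Test M.arity M.testArity → M.Cfg → Prop
  | .read i, c' => c' = ⟨c.line + 1, Function.update c.reg i (x.map M.incl)⟩
  | .write _, c' => c' = ⟨c.line + 1, c.reg⟩
  | .const i w, c' => c' = ⟨c.line + 1, Function.update c.reg i (w.map M.incl)⟩
  | .copy i j, c' => c' = ⟨c.line + 1, Function.update c.reg i (c.reg j)⟩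
  | .apply i F p, c' => ∃ y, M.op F (fun k => c.reg (p k)) y ∧
      c' = ⟨c.line + 1, Function.update c.reg i y⟩
  | .goto l, c' => c' = ⟨l, c.reg⟩
  | .ifGoto F p l, c' =>
      ((fun k => c.reg (p k)) ∈ M.test F ∧ c' = ⟨l, c.reg⟩) ∨
      ((fun k => c.reg (p k)) ∉ M.test F ∧ c' = ⟨c.line + 1, c.reg⟩)
  | .halt, _ => False
  | .haltAccept, _ => False
  | .haltReject, _ => False

/-- One step on input `x` that does not halt. -/
def Step (x : List A) (c c' : M.Cfg) : Prop :=
  ∃ I, M.program[c.line]? = some I ∧ M.Perform x c I c'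

/-- Some computation path on input `x` halts with `halt_accept` after exactly `t` steps; performing
`halt_accept` is the last of these steps. -/
def AcceptsIn (x : List A) (t : ℕ) : Prop :=
  ∃ s c, t = s + 1 ∧ StepsTo (M.Step x) s M.init c ∧ M.program[c.line]? = some .haltAccept

/-- A nondeterministic automatic register machine: the operations are bounded automatic
relations. (The truth-valued operations have no result string whose length could be bounded.) -/
def IsNARM : Prop := ∀ F, IsBounded (M.op F)

end ARM

/-- `BNAL f`: the languages over `A` accepted by nondeterministic automatic register machines with
bounded automatic relations in `O(f(n))` steps. A string is accepted if some path accepts it; all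
accepting paths have to obey the bound on the number of steps. -/
def BNAL (A : Type*) (f : ℕ → ℝ) : Set (Language A) :=
  {L | ∃ M : ARM A, M.IsNARM ∧ (∀ x : List A, x ∈ L ↔ ∃ t, M.AcceptsIn x t) ∧
    ∃ g : ℕ → ℕ, (fun n => (g n : ℝ)) =O[atTop] f ∧
      ∀ (x : List A) (t : ℕ), M.AcceptsIn x t → t ≤ g x.length}

/-- `BNAL[poly(n)]` -/
def BNALPoly (A : Type*) : Set (Language A) := ⋃ k : ℕ, BNAL A fun n => (n : ℝ) ^ k

/-! ### Nondeterministic Turing machines and NP -/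

inductive Move
  | left | right | stay

/-- A nondeterministic Turing machine with input alphabet `A` and one tape that is infinite to the
right. -/
structure NTM (A : Type*) where
  /-- the tape alphabet -/
  Γ : Type
  finiteΓ : Finite Γ
  /-- the symbol of an empty cell -/
  blank : Γ
  /-- the inclusion of the input alphabet in the tape alphabet -/
  incl : A ↪ Γ
  incl_ne_blank : ∀ a, incl a ≠ blank
  /-- the states -/
  Q : Type
  finiteQ : Finite Q
  start : Q
  accept : Q
  reject : Q
  accept_ne_reject : accept ≠ reject
  /-- the possible actions for a state and a scanned symbol -/
  δ : Q → Γ → Set (Q × Γ × Move)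

namespace NTM

variable {A : Type*} (M : NTM A)

/-- A configuration: the state, the position of the head, and the contents of the tape. -/
structure Cfg where
  state : M.Q
  head : ℕ
  tape : ℕ → M.Γ

/-- The input is on the leftmost cells, all other cells are empty, and the head is on the leftmost
cell. -/
def init (x : List A) : M.Cfg :=
  ⟨M.start, 0, fun i => (x.map M.incl).getD i M.blank⟩

/-- The new position of the head; on the leftmost cell, a move to the left has no effect. -/
def moveHead (h : ℕ) : Move → ℕ
  | .left => h - 1
  | .right => h + 1
  | .stay => h

/-- One step; there is none from the two halting states. -/
def Step (c c' : M.Cfg) : Prop :=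
  c.state ≠ M.accept ∧ c.state ≠ M.reject ∧
    ∃ q a m, (q, a, m) ∈ M.δ c.state (c.tape c.head) ∧
      c' = ⟨q, moveHead c.head m, Function.update c.tape c.head a⟩

/-- Some computation path on input `x` reaches the accepting state. -/
def Accepts (x : List A) : Prop :=
  ∃ t c, StepsTo M.Step t (M.init x) c ∧ c.state = M.accept

end NTM

/-- `NTIME f`: the languages over `A` accepted by nondeterministic Turing machines all of whose
computation paths, on any input of length `n`, end after `O(f(n))` steps. -/
def NTIME (A : Type*) (f : ℕ → ℝ) : Set (Language A) :=
  {L | ∃ M : NTM A, (∀ x : List A, x ∈ L ↔ M.Accepts x) ∧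
    ∃ g : ℕ → ℕ, (fun n => (g n : ℝ)) =O[atTop] f ∧
      ∀ (x : List A) (t : ℕ) (c : M.Cfg), StepsTo M.Step t (M.init x) c → t ≤ g x.length}

/-- `NP` -/
def NP (A : Type*) : Set (Language A) := ⋃ k : ℕ, NTIME A fun n => (n : ℝ) ^ k

end AutReg

/-! Both inclusions rest on one observation: a configuration can be written as a tuple of strings in
such a way that a computation step is a condition on the columns of a convolution, and a finite
automaton can check it.

From register machines to Turing machines, the columns of the tuple become the tape. One application
of an automatic relation is a sweep: the head moves right, guesses the new columns, runs the
automaton on the pairs of old and new ones, and returns (`mem_NP_of_iterate`). Lengths grow by at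
most a constant per application, so polynomially many applications cost polynomial time. However,
`NTIME` bounds all paths, whereas `BNAL` bounds only the accepting ones, so two kinds of runaway
path have to be cut off. A sweep could go on guessing forever; it is therefore confined to automaton
states from which acceptance can still be reached, and this bounds its length (`sweep_length_le`).
The register machine could run forever; the tuple therefore contains a clock of `K` strings whose
lengths, at most `n + 1`, are the digits of a number that is guessed at the start and decreases
lexicographically in every step (`SimStep`, `simSteps_inv`). Comparing lengths is automatic, and `K`
is chosen such that `(n + 2) ^ K` exceeds the length of every accepting path.

From Turing machines to register machines, a configuration is the string of its first cells, the
scanned one carrying the state. A step acts only next to the head, so it is a condition on two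
consecutive columns (`stepRel_encode_iff`) and hence automatic; the new string is one cell longer,
so the relation is bounded. A loop of three instructions performs one step. -/

namespace AutReg

/-! ### Columns of tuples of strings -/

section Columns

variable {ι Γ : Type}

/-- The `i`-th column of a tuple of strings; it is empty (constantly `none`) from the end of the
longest string on. -/
def col (z : ι → List Γ) (i : ℕ) : ι → Option Γ := fun j => (z j)[i]?

/-- The empty column. -/
def blankCol : ι → Option Γ := fun _ => none

theorem col_injective : Function.Injective (col : (ι → List Γ) → ℕ → ι → Option Γ) := by
  intro z z' h
  funext j
  exact List.ext_getElem? fun i => congrFun (congrFun h i) j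

variable [Fintype ι]

theorem lt_maxLen_iff {z : ι → List Γ} {i : ℕ} : i < maxLen z ↔ ∃ j, i < (z j).length := by
  simp [maxLen, Finset.lt_sup_iff]

theorem length_le_maxLen (z : ι → List Γ) (j : ι) : (z j).length ≤ maxLen z :=
  Finset.le_sup (f := fun j => (z j).length) (Finset.mem_univ j)

theorem maxLen_le_iff {z : ι → List Γ} {m : ℕ} : maxLen z ≤ m ↔ ∀ j, (z j).length ≤ m := by
  simp [maxLen]

theorem col_eq_blankCol_iff {z : ι → List Γ} {i : ℕ} : col z i = blankCol ↔ maxLen z ≤ i := by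
  rw [← not_lt, lt_maxLen_iff, funext_iff]
  simp [col, blankCol]

theorem getElem?_conv (z : ι → List Γ) (i : ℕ) :
    (conv z)[i]? = if i < maxLen z then some (col z i) else none := by
  split_ifs with h
  · simp [conv, h]
    rfl
  · simp [conv, not_lt.1 h]

@[simp] theorem length_conv (z : ι → List Γ) : (conv z).length = maxLen z := by simp [conv]

theorem conv_eq_map_col (z : ι → List Γ) : conv z = (List.range (maxLen z)).map (col z) := rfl

theorem getD_getElem?_conv (z : ι → List Γ) (i : ℕ) : (conv z)[i]?.getD blankCol = col z i := by
  rw [getElem?_conv]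
  split_ifs with h
  · rfl
  · exact (col_eq_blankCol_iff.2 (not_lt.1 h)).symm

theorem conv_injective : Function.Injective (conv : (ι → List Γ) → List (ι → Option Γ)) := by
  intro z z' h
  apply col_injective
  funext i
  rw [← getD_getElem?_conv, h, getD_getElem?_conv]

end Columns

/-! ### Strictly local languages are regular -/

section Local

variable {α : Type}

/-- The automaton that remembers the last letter and whether it was the first one, and checks a
condition on any two consecutive letters. -/
noncomputable def localDFA (Q : Bool → Option α → Option α → Prop) :
    DFA α (Option (Option (Bool × α))) where
  step s a := by
    classical
    exact match s with
    | none => none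
    | some none => some (some (true, a))
    | some (some (b, c)) => if Q b (some c) (some a) then some (some (false, a)) else none
  start := some none
  accept := {s | match s with
    | none => False
    | some none => Q true none none
    | some (some (b, c)) => Q b (some c) none}

theorem localDFA_evalFrom_none (Q : Bool → Option α → Option α → Prop) (u : List α) :
    (localDFA Q).evalFrom none u = none := by
  induction u with
  | nil => rfl
  | cons a u ih => simpa [DFA.evalFrom_cons, localDFA] using ih

/-- The index `i` runs over all naturals, so the condition is also asked behind the end of the word;
`hQ` makes it hold there. The flag `b` survives only at position `0`, since every later letter is
stored with `false`. -/
theorem localDFA_evalFrom {Q : Bool → Option α → Option α → Prop} (hQ : Q false none none)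
    (u : List α) (b : Bool) (c : α) :
    (localDFA Q).evalFrom (some (some (b, c))) u ∈ (localDFA Q).accept ↔
      ∀ i, Q (b && i == 0) (c :: u)[i]? (c :: u)[i + 1]? := by
  induction u generalizing b c with
  | nil =>
    constructor
    · intro h i
      rcases i with _ | i
      · simpa [localDFA] using h
      · simpa using hQ
    · intro h
      simpa [localDFA] using h 0
  | cons a u ih =>
    rw [DFA.evalFrom_cons]
    by_cases h : Q b (some c) (some a)
    · have : (localDFA Q).step (some (some (b, c))) a = some (some (false, a)) := by
        simp [localDFA, h]
      rw [this, ih]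
      constructor
      · intro h' i
        rcases i with _ | i
        · simpa using h
        · simpa using h' i
      · intro h' i
        simpa using h' (i + 1)
    · have : (localDFA Q).step (some (some (b, c))) a = none := by
        simp [localDFA, h]
      rw [this, localDFA_evalFrom_none]
      refine iff_of_false (by simp [localDFA]) fun h' => h ?_
      simpa using h' 0

theorem isRegular_local [Finite α] {Q : Bool → Option α → Option α → Prop}
    (hQ : Q false none none) :
    Language.IsRegular ({u | ∀ i : ℕ, Q (i == 0) u[i]? u[i + 1]?} : Set (List α)) := by
  refine ⟨_, Fintype.ofFinite _, localDFA Q, ?_⟩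
  ext u
  rw [DFA.mem_accepts]
  rcases u with _ | ⟨a, u⟩
  · constructor
    · intro h i
      rcases i with _ | i
      · simpa [localDFA, DFA.eval] using h
      · simpa using hQ
    · intro h
      simpa [localDFA, DFA.eval] using h 0
  · have : (localDFA Q).eval (a :: u) = (localDFA Q).evalFrom (some (some (true, a))) u := rfl
    rw [this, localDFA_evalFrom hQ]
    simp only [Bool.true_and]
    rfl

/-- Myhill–Nerode: a left quotient of `{u}` is empty or consists of one suffix of `u`, so there are
finitely many. -/
theorem isRegular_singleton (u : List α) : Language.IsRegular ({u} : Set (List α)) := by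
  apply Language.IsRegular.of_finite_range_leftQuotient
  have hfin : (insert (∅ : Set (List α)) ((fun v : List α => ({v} : Set (List α))) ''
      {v | v ∈ u.tails})).Finite :=
    ((u.tails.finite_toSet).image _).insert _
  refine hfin.subset ?_
  rintro _ ⟨x, rfl⟩
  by_cases h : x <+: u
  · obtain ⟨v, rfl⟩ := h
    right
    refine ⟨v, by simp, ?_⟩
    ext y
    change y = v ↔ x ++ y = x ++ v
    simp
  · left
    ext y
    change x ++ y = u ↔ False
    simp only [iff_false]
    rintro rfl
    exact h (by simp)

end Local

/-! ### Relations recognized by automata, and automatic relations -/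

section Recognizable

variable {ι κ Γ : Type} [Fintype ι] [Fintype κ]

/-- A relation between strings is recognizable if a regular language separates the convolutions of
its tuples from those of the other tuples. -/
def Recognizable (P : (ι → List Γ) → Prop) : Prop :=
  ∃ L : Language (ι → Option Γ), L.IsRegular ∧ ∀ z, P z ↔ conv z ∈ L

/-- By `h`, the letters on which `f` is defined form a prefix, so dropping the others shifts no
index. This recovers one string from its track in a convolution. -/
theorem getElem?_filterMap_of_prefix {α β : Type} (f : α → Option β) (u : List α)
    (h : ∀ i : ℕ, u[i]?.bind f = none → u[i + 1]?.bind f = none) (i : ℕ) :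
    (u.filterMap f)[i]? = u[i]?.bind f := by
  induction u generalizing i with
  | nil => simp
  | cons a u ih =>
    have ih' := ih fun i hi => by simpa using h (i + 1) (by simpa using hi)
    cases hfa : f a with
    | some b =>
      rw [List.filterMap_cons_some hfa]
      rcases i with _ | i
      · simp [hfa]
      · simpa using ih' i
    | none =>
      have hnone : ∀ i : ℕ, (a :: u)[i]?.bind f = none := by
        intro i
        induction i with
        | zero => simpa using hfa
        | succ i ihi => exact h i ihi
      rw [hnone, List.filterMap_cons_none hfa, ih']
      simpa using hnone (i + 1)

/-- Convolutions are characterized locally: no letter is the empty column, and on each track padding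
is followed only by padding. -/
theorem isRegular_range_conv [Finite Γ] :
    Language.IsRegular (Set.range (conv : (ι → List Γ) → List (ι → Option Γ))) := by
  suffices (Set.range (conv : (ι → List Γ) → List (ι → Option Γ))) = {u | ∀ i : ℕ,
      u[i]? ≠ some blankCol ∧ ∀ j, u[i]?.bind (· j) = none → u[i + 1]?.bind (· j) = none} by
    rw [this]
    exact isRegular_local (α := ι → Option Γ) (Q := fun _ cur nxt =>
      cur ≠ some blankCol ∧ ∀ j, cur.bind (· j) = none → nxt.bind (· j) = none) (by simp)
  ext u
  constructor
  · rintro ⟨z, rfl⟩ i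
    rw [getElem?_conv, getElem?_conv]
    constructor
    · split_ifs with h
      · simpa [col_eq_blankCol_iff] using h
      · simp
    · intro j
      split_ifs with h h'
      · simp only [Option.bind_some, col, List.getElem?_eq_none_iff]
        omega
      · simp
      · omega
      · simp
  · intro hu
    have hcol : ∀ i, col (fun j => u.filterMap (· j)) i = fun j => u[i]?.bind (· j) := fun i =>
      funext fun j => getElem?_filterMap_of_prefix _ u (fun i => (hu i).2 j) i
    refine ⟨fun j => u.filterMap (· j), List.ext_getElem? fun i => ?_⟩
    -- No letter of `u` is the empty column, so the longest recovered string is as long as `u`.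
    have key : i < maxLen (fun j => u.filterMap (· j)) ↔ i < u.length := by
      rw [← not_iff_not, not_lt, ← col_eq_blankCol_iff, hcol, not_lt]
      constructor
      · intro h
        by_contra hi
        apply (hu i).1
        rw [List.getElem?_eq_getElem (by omega)] at h ⊢
        simpa using h
      · intro h
        rw [List.getElem?_eq_none h]
        rfl
    rw [getElem?_conv, hcol]
    split_ifs with h
    · rw [List.getElem?_eq_getElem (key.1 h)]
      rfl
    · rw [List.getElem?_eq_none (not_lt.1 fun h' => h (key.2 h'))]

/-- A recognizing language may contain words that are no convolutions, which is what makes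
complements harmless; intersecting with the regular set of convolutions removes them. -/
theorem Recognizable.isAutomatic [Finite Γ] {P : (ι → List Γ) → Prop} (h : Recognizable P) :
    IsAutomatic {z | P z} := by
  obtain ⟨L, hL, hP⟩ := h
  have : (conv '' {z | P z} : Set (List (ι → Option Γ))) =
      (L ⊓ (Set.range conv : Set (List (ι → Option Γ))) : Language _) := by
    ext u
    constructor
    · rintro ⟨z, hz, rfl⟩
      exact ⟨(hP z).1 hz, z, rfl⟩
    · rintro ⟨hu, z, rfl⟩
      exact ⟨z, (hP z).2 hu, rfl⟩
  unfold IsAutomatic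
  rw [this]
  exact hL.inf isRegular_range_conv

theorem IsAutomatic.recognizable {S : Set (ι → List Γ)} (h : IsAutomatic S) :
    Recognizable (· ∈ S) :=
  ⟨_, h, fun _ => (conv_injective.mem_set_image).symm⟩

namespace Recognizable

theorem congr {P P' : (ι → List Γ) → Prop} (h : Recognizable P) (e : ∀ z, P' z ↔ P z) :
    Recognizable P' := by
  obtain ⟨L, hL, hP⟩ := h
  exact ⟨L, hL, fun z => (e z).trans (hP z)⟩

theorem not {P : (ι → List Γ) → Prop} (h : Recognizable P) : Recognizable fun z => ¬ P z := by
  obtain ⟨L, hL, hP⟩ := h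
  exact ⟨_, hL.compl, fun z => not_congr (hP z)⟩

theorem and {P P' : (ι → List Γ) → Prop} (h : Recognizable P) (h' : Recognizable P') :
    Recognizable fun z => P z ∧ P' z := by
  obtain ⟨L, hL, hP⟩ := h
  obtain ⟨L', hL', hP'⟩ := h'
  exact ⟨_, hL.inf hL', fun z => and_congr (hP z) (hP' z)⟩

theorem or {P P' : (ι → List Γ) → Prop} (h : Recognizable P) (h' : Recognizable P') :
    Recognizable fun z => P z ∨ P' z :=
  (h.not.and h'.not).not.congr fun z => by tauto

theorem const (p : Prop) : Recognizable fun _ : ι → List Γ => p := by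
  by_cases h : p
  · refine ⟨⊤, ⟨Unit, inferInstance, ⟨fun _ _ => (), (), Set.univ⟩, ?_⟩,
      fun z => iff_of_true h trivial⟩
    ext u
    exact iff_of_true trivial trivial
  · refine ⟨⊥, ⟨Unit, inferInstance, ⟨fun _ _ => (), (), ∅⟩, ?_⟩, fun z => iff_of_false h id⟩
    ext u
    exact iff_of_false id id

theorem forall_finite {β : Type*} [Finite β] {P : β → (ι → List Γ) → Prop}
    (h : ∀ b, Recognizable (P b)) : Recognizable fun z => ∀ b, P b z := by
  classical
  have := Fintype.ofFinite β
  suffices ∀ s : Finset β, Recognizable fun z => ∀ b ∈ s, P b z from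
    (this Finset.univ).congr fun z => by simp
  intro s
  induction s using Finset.induction_on with
  | empty => exact (const True).congr fun z => by simp
  | insert b s _ ih => exact ((h b).and ih).congr fun z => by simp

theorem exists_finite {β : Type*} [Finite β] {P : β → (ι → List Γ) → Prop}
    (h : ∀ b, Recognizable (P b)) : Recognizable fun z => ∃ b, P b z :=
  (forall_finite fun b => (h b).not).not.congr fun z => by simp

/-- A condition on any two consecutive columns is recognizable. -/
theorem of_local [Finite Γ] {Q : Bool → (ι → Option Γ) → (ι → Option Γ) → Prop}
    (hQ : Q false blankCol blankCol) :
    Recognizable fun z => ∀ i : ℕ, Q (i == 0) (col z i) (col z (i + 1)) :=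
  ⟨_, isRegular_local (α := ι → Option Γ)
    (Q := fun b c d => Q b (c.getD blankCol) (d.getD blankCol)) hQ, fun z => by
      refine forall_congr' fun i => ?_
      rw [← getD_getElem?_conv, ← getD_getElem?_conv]⟩

/-- A condition on every column is recognizable. -/
theorem of_forall_col [Finite Γ] {Q : (ι → Option Γ) → Prop} (hQ : Q blankCol) :
    Recognizable fun z => ∀ i : ℕ, Q (col z i) :=
  of_local (Q := fun _ c _ => Q c) hQ

/-- The automaton that reads a tuple of strings as the tuple given by a map between the indices. -/
noncomputable def comapDFA {σ : Type} (f : ι → κ) (D : DFA (ι → Option Γ) σ) :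
    DFA (κ → Option Γ) σ where
  step s a := by
    classical
    exact if a ∘ f = blankCol then s else D.step s (a ∘ f)
  start := D.start
  accept := D.accept

/-- In a convolution, the columns that become empty along `f` are exactly those behind the end of `z
∘ f`. Skipping them makes the automaton read `conv (z ∘ f)`, even if `z` is longer. -/
theorem comap {P : (ι → List Γ) → Prop} (h : Recognizable P) (f : ι → κ) :
    Recognizable fun z : κ → List Γ => P (z ∘ f) := by
  obtain ⟨L, ⟨σ, _, D, rfl⟩, hP⟩ := h
  refine ⟨(comapDFA f D).accepts, ⟨σ, inferInstance, _, rfl⟩, fun z => ?_⟩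
  refine (hP _).trans ?_
  rw [DFA.mem_accepts, DFA.mem_accepts]
  suffices (comapDFA f D).eval (conv z) = D.eval (conv (z ∘ f)) by
    rw [this]; rfl
  have hcol : ∀ i, col z i ∘ f = col (z ∘ f) i := fun i => rfl
  have key : ∀ m, (comapDFA f D).eval ((List.range m).map (col z)) =
      D.eval ((List.range (min m (maxLen (z ∘ f)))).map (col (z ∘ f))) := by
    intro m
    induction m with
    | zero => simp; rfl
    | succ m ih =>
      rw [List.range_succ, List.map_append, List.map_singleton, DFA.eval_append_singleton, ih]
      by_cases hm : maxLen (z ∘ f) ≤ m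
      · rw [min_eq_right hm, min_eq_right (by omega)]
        simp [comapDFA, hcol, col_eq_blankCol_iff.2 hm]
      · rw [min_eq_left (by omega), min_eq_left (by omega), List.range_succ, List.map_append,
          List.map_singleton, DFA.eval_append_singleton]
        have : col (z ∘ f) m ≠ blankCol := mt col_eq_blankCol_iff.1 hm
        simp [comapDFA, hcol, this]
  rw [conv_eq_map_col, key, min_eq_right]
  · rfl
  · exact maxLen_le_iff.2 fun j => length_le_maxLen z (f j)

/-- The case of a single string is a singleton language; the general one is a reindexing of it. -/
theorem eq_const (j : ι) (w : List Γ) : Recognizable fun z : ι → List Γ => z j = w := by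
  have : Recognizable fun z : Unit → List Γ => z = fun _ => w :=
    ⟨_, isRegular_singleton (conv fun _ => w), fun z => conv_injective.eq_iff.symm⟩
  exact (this.comap fun _ => j).congr fun z => by simp [funext_iff]

theorem eq [Finite Γ] (j k : ι) : Recognizable fun z : ι → List Γ => z j = z k :=
  (of_forall_col (Q := fun c => c j = c k) rfl).congr fun _ =>
    List.ext_getElem?_iff

theorem length_le [Finite Γ] (j k : ι) :
    Recognizable fun z : ι → List Γ => (z j).length ≤ (z k).length :=
  (of_forall_col (Q := fun c => c k = none → c j = none) fun _ => rfl).congr fun z => by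
    simp only [col, List.getElem?_eq_none_iff]
    exact ⟨fun h i => h.trans, fun h => h _ le_rfl⟩

theorem length_lt [Finite Γ] (j k : ι) :
    Recognizable fun z : ι → List Γ => (z j).length < (z k).length :=
  (length_le k j).not.congr fun _ => not_le.symm

theorem length_le_succ [Finite Γ] (j k : ι) :
    Recognizable fun z : ι → List Γ => (z j).length ≤ (z k).length + 1 :=
  (of_local (Q := fun _ c d => c k = none → d j = none) fun _ => rfl).congr fun z => by
    simp only [col, List.getElem?_eq_none_iff]
    exact ⟨fun h i hi => by omega, fun h => h _ le_rfl⟩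

end Recognizable

end Recognizable

/-! ### Paths and polynomial bounds -/

theorem exists_stepsTo_iff {α : Type*} {r : α → α → Prop} {a b : α} :
    (∃ n, StepsTo r n a b) ↔ Relation.ReflTransGen r a b := by
  constructor
  · rintro ⟨n, h⟩
    induction h with
    | zero => rfl
    | succ _ hr ih => exact ih.tail hr
  · intro h
    induction h with
    | refl => exact ⟨0, .zero _⟩
    | tail _ hr ih => exact ih.imp' (· + 1) fun n hn => .succ hn hr

/-- Bounds by `C * (n + 1) ^ k` replace the `O`-notation because they hold for all `n`, including
`0`. -/
theorem isBigO_pow_of_le {g : ℕ → ℕ} {C k : ℕ} (h : ∀ n, g n ≤ C * (n + 1) ^ k) :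
    (fun n => (g n : ℝ)) =O[atTop] fun n : ℕ => (n : ℝ) ^ k := by
  refine IsBigO.of_bound (C * 2 ^ k) ?_
  filter_upwards [eventually_ge_atTop 1] with n hn
  rw [Real.norm_of_nonneg (by positivity), Real.norm_of_nonneg (by positivity), mul_assoc,
    ← mul_pow]
  calc (g n : ℝ) ≤ C * (n + 1 : ℝ) ^ k := by exact_mod_cast h n
    _ ≤ C * (2 * n : ℝ) ^ k := by
      have : (1 : ℝ) ≤ n := by exact_mod_cast hn
      gcongr
      linarith

theorem exists_le_of_isBigO_pow {g : ℕ → ℕ} {k : ℕ}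
    (h : (fun n => (g n : ℝ)) =O[atTop] fun n : ℕ => (n : ℝ) ^ k) :
    ∃ C, ∀ n, g n ≤ C * (n + 1) ^ k := by
  obtain ⟨c, hc⟩ := h.bound
  obtain ⟨N, hN⟩ := eventually_atTop.1 hc
  -- The sum covers the finitely many arguments below the threshold `N`.
  refine ⟨⌈c⌉₊ + ∑ i ∈ Finset.range N, g i, fun n => ?_⟩
  have hpos : 1 ≤ (n + 1) ^ k := Nat.one_le_pow _ _ (by omega)
  by_cases hn : N ≤ n
  · have h1 := hN n hn
    rw [Real.norm_of_nonneg (by positivity), Real.norm_of_nonneg (by positivity)] at h1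
    have h2 : (g n : ℝ) ≤ ⌈c⌉₊ * (n + 1 : ℝ) ^ k :=
      h1.trans (mul_le_mul (Nat.le_ceil c) (by gcongr; linarith) (by positivity) (by positivity))
    have h3 : g n ≤ ⌈c⌉₊ * (n + 1) ^ k := by exact_mod_cast h2
    exact h3.trans (Nat.mul_le_mul_right _ (Nat.le_add_right _ _))
  · have h1 : g n ≤ ∑ i ∈ Finset.range N, g i :=
      Finset.single_le_sum (f := g) (fun _ _ => Nat.zero_le _) (Finset.mem_range.2 (by omega))
    nlinarith

/-! ### Turing machines that iterate an automatic relation -/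

section Sweep

/-- The states of a machine that sweeps over its tape: running an automaton to the right (and
whether this is the first cell), going back to the left, and the halting states. -/
inductive SweepState (σ : Type)
  | sweep (first : Bool) (d : σ)
  | back
  | accept
  | reject

theorem finite_sweepState (σ : Type) [Finite σ] : Finite (SweepState σ) :=
  Finite.of_surjective
    (fun s : (Bool × σ) ⊕ Fin 3 => match s with
      | .inl (b, d) => SweepState.sweep b d
      | .inr 0 => .back
      | .inr 1 => .accept
      | .inr 2 => .reject)
    (by
      rintro (⟨b, d⟩ | _ | _ | _)
      · exact ⟨.inl (b, d), rfl⟩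
      · exact ⟨.inr 0, rfl⟩
      · exact ⟨.inr 1, rfl⟩
      · exact ⟨.inr 2, rfl⟩)

variable {J Γ σ : Type}

/-- The actions of a machine whose tape holds the columns of a tuple of strings, and a mark on the
first cell. In a sweep, the columns are replaced by guessed ones while the automaton `D` reads the
old and the new ones; the machine then goes back, and accepts or starts the next sweep. -/
inductive SweepAct (D : DFA (J ⊕ J → Option Γ) σ) (acc : Set (J → Option Γ)) :
    SweepState σ → Bool × (J → Option Γ) → SweepState σ × (Bool × (J → Option Γ)) × Move → Prop
  | letter (b : Bool) (d : σ) (f : Bool) (o n : J → Option Γ) (h : o ≠ blankCol ∨ n ≠ blankCol)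
      (hco : ∃ v, D.evalFrom (D.step d (Sum.elim o n)) v ∈ D.accept) :
      SweepAct D acc (.sweep b d) (f, o) (.sweep false (D.step d (Sum.elim o n)), (b, n), .right)
  | turn (d : σ) (f : Bool) (h : d ∈ D.accept) :
      SweepAct D acc (.sweep false d) (f, blankCol) (.back, (f, blankCol), .left)
  | back (o : J → Option Γ) : SweepAct D acc .back (false, o) (.back, (false, o), .left)
  | restart (o : J → Option Γ) :
      SweepAct D acc .back (true, o) (.sweep true D.start, (true, o), .stay)
  | accept (o : J → Option Γ) (h : o ∈ acc) :
      SweepAct D acc .back (true, o) (.accept, (true, o), .stay)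

/-- The tuple whose only nonempty string is `w`. -/
noncomputable def singleTuple (inp : J) (w : List Γ) : J → List Γ := by
  classical
  exact Function.update (fun _ => []) inp w

theorem singleTuple_self (inp : J) (w : List Γ) : singleTuple inp w inp = w := by
  simp [singleTuple]

theorem singleTuple_of_ne {inp j : J} (h : j ≠ inp) (w : List Γ) : singleTuple inp w j = [] := by
  simp [singleTuple, h]

/-- The column with the letter `a` in one string, where the other strings have ended. -/
noncomputable def singleCol (inp : J) (a : Γ) : J → Option Γ := by
  classical
  exact Function.update blankCol inp (some a)

theorem col_singleTuple (inp : J) (w : List Γ) (i : ℕ) :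
    col (singleTuple inp w) i = (w[i]?.map (singleCol inp)).getD blankCol := by
  funext j
  by_cases hj : j = inp
  · subst hj
    cases h : w[i]? <;> simp [col, singleTuple, singleCol, h, blankCol]
  · cases w[i]? <;> simp [col, singleTuple, singleCol, blankCol, hj]

/-- The machine with the actions `SweepAct D acc`. -/
noncomputable def sweepNTM {A : Type*} [Finite J] [Finite Γ] [Finite σ] (incl : A ↪ Γ) (inp : J)
    (D : DFA (J ⊕ J → Option Γ) σ) (acc : Set (J → Option Γ)) : NTM A where
  Γ := Bool × (J → Option Γ)
  finiteΓ := inferInstance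
  blank := (false, blankCol)
  incl := ⟨fun a => (false, singleCol inp (incl a)), fun a b h => incl.injective (by
    have := congrFun (congrArg Prod.snd h) inp
    simpa [singleCol] using this)⟩
  incl_ne_blank a h := by
    have := congrFun (congrArg Prod.snd h) inp
    simp [singleCol, blankCol] at this
  Q := SweepState σ
  finiteQ := finite_sweepState σ
  start := .sweep true D.start
  accept := .accept
  reject := .reject
  accept_ne_reject := by simp
  δ s a := {t | SweepAct D acc s a t}

/-- The tape with the columns of `z`, where the first cell is marked if `b` holds. -/
def sweepTape (b : Bool) (z : J → List Γ) : ℕ → Bool × (J → Option Γ) :=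
  fun i => (b && i == 0, col z i)

/-- The tape where the first `h` columns of `z` have been replaced by those of `u`. -/
def midTape (z : J → List Γ) (u : ℕ → J → Option Γ) (h : ℕ) : ℕ → Bool × (J → Option Γ) :=
  fun i => if i < h then (i == 0, u i) else (false, col z i)

/-- The word that the automaton has read when the first `h` columns of `z` have been replaced by
those of `u`. -/
def sweepWord (z : J → List Γ) (u : ℕ → J → Option Γ) (h : ℕ) : List (J ⊕ J → Option Γ) :=
  (List.range h).map fun i => Sum.elim (col z i) (u i)

theorem getElem?_sweepWord {z : J → List Γ} {u : ℕ → J → Option Γ} {h i : ℕ} (hi : i < h) :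
    (sweepWord z u h)[i]? = some (Sum.elim (col z i) (u i)) := by
  simp [sweepWord, hi]

theorem sweepWord_succ (z : J → List Γ) (u : ℕ → J → Option Γ) (h : ℕ) :
    sweepWord z u (h + 1) = sweepWord z u h ++ [Sum.elim (col z h) (u h)] := by
  simp [sweepWord, List.range_succ]

theorem sweepWord_congr {z : J → List Γ} {u u' : ℕ → J → Option Γ} {h : ℕ}
    (e : ∀ i < h, u i = u' i) : sweepWord z u h = sweepWord z u' h :=
  List.map_congr_left fun i hi => by rw [e i (List.mem_range.1 hi)]

theorem col_sumElim (z z' : J → List Γ) (i : ℕ) :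
    col (Sum.elim z z') i = Sum.elim (col z i) (col z' i) := by
  funext j
  rcases j with j | j <;> rfl

theorem conv_sumElim [Fintype J] (z z' : J → List Γ) :
    conv (Sum.elim z z') = sweepWord z (col z') (maxLen (Sum.elim z z')) := by
  rw [conv_eq_map_col]
  exact List.map_congr_left fun i _ => col_sumElim z z' i

theorem col_eq_of_sweepWord_append [Fintype J] {z y y' : J → List Γ} {u : ℕ → J → Option Γ} {h : ℕ}
    {v : List (J ⊕ J → Option Γ)} (e : sweepWord z u h ++ v = conv (Sum.elim y y')) {i : ℕ}
    (hi : i < h) : col z i = col y i ∧ u i = col y' i := by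
  have h1 : (conv (Sum.elim y y'))[i]? = some (Sum.elim (col z i) (u i)) := by
    rw [← e, List.getElem?_append_left (by simpa [sweepWord] using hi), getElem?_sweepWord hi]
  have h2 := getD_getElem?_conv (Sum.elim y y') i
  rw [h1, col_sumElim, Option.getD_some] at h2
  exact ⟨funext fun j => congrFun h2 (.inl j), funext fun j => congrFun h2 (.inr j)⟩

theorem update_sweepTape_zero (b : Bool) (z : J → List Γ) (n : J → Option Γ) :
    Function.update (sweepTape b z) 0 (true, n) = midTape z (fun _ => n) 1 := by
  funext i
  rcases i with _ | i <;> simp [midTape, sweepTape]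

theorem update_midTape {h : ℕ} (hh : 0 < h) (z : J → List Γ) (u : ℕ → J → Option Γ)
    (n : J → Option Γ) :
    Function.update (midTape z u h) h (false, n) =
      midTape z (Function.update u h n) (h + 1) := by
  funext i
  rcases lt_trichotomy i h with hi | rfl | hi
  · simp [midTape, hi, hi.ne, Nat.lt_succ_of_lt hi]
  · simp [midTape]
    omega
  · simp [midTape, hi.ne', hi.not_gt, show ¬ i < h + 1 by omega]

/-! ### What a single sweep can do -/

variable [Fintype J] {D : DFA (J ⊕ J → Option Γ) σ} {S : Set (J ⊕ J → List Γ)}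

theorem exists_conv_eq_of_eval_mem (hD : D.accepts = conv '' S) {w : List (J ⊕ J → Option Γ)}
    (h : D.eval w ∈ D.accept) : ∃ y y', Sum.elim y y' ∈ S ∧ w = conv (Sum.elim y y') := by
  have : w ∈ D.accepts := h
  rw [hD] at this
  obtain ⟨y, hy, rfl⟩ := this
  have e : Sum.elim (y ∘ .inl) (y ∘ .inr) = y := Sum.elim_comp_inl_inr y
  exact ⟨y ∘ .inl, y ∘ .inr, by rwa [e], by rw [e]⟩

/-- By `hco`, the word read so far extends to the convolution of a pair `y`, `y'` in `S`. If `h`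
exceeded the bound, `y` would end where `z` does, so `y'` would end before column `h - 1`. That
column would then be empty on both sides, against `hne`. -/
theorem sweep_length_le (hD : D.accepts = conv '' S) {c : ℕ}
    (hc : ∀ z z', Sum.elim z z' ∈ S → maxLen z' ≤ maxLen z + c)
    {z : J → List Γ} {u : ℕ → J → Option Γ} {h : ℕ}
    (hne : ∀ i < h, col z i ≠ blankCol ∨ u i ≠ blankCol)
    (hco : ∃ v, D.evalFrom (D.eval (sweepWord z u h)) v ∈ D.accept) : h ≤ maxLen z + c := by
  obtain ⟨v, hv⟩ := hco
  rw [DFA.eval, ← DFA.evalFrom_of_append] at hv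
  obtain ⟨y, y', hy, e⟩ := exists_conv_eq_of_eval_mem hD hv
  by_contra! hlt
  have h1 : maxLen y ≤ maxLen z := by
    -- The column of `z` just behind its end has been read, and `y` has the same one.
    rw [← col_eq_blankCol_iff, ← (col_eq_of_sweepWord_append e (by omega)).1]
    exact col_eq_blankCol_iff.2 le_rfl
  have h2 := hc y y' hy
  obtain ⟨h3, h4⟩ := col_eq_of_sweepWord_append e (i := h - 1) (by omega)
  rcases hne (h - 1) (by omega) with h5 | h5
  · exact h5 (col_eq_blankCol_iff.2 (by omega))
  · exact h5 (h4.trans (col_eq_blankCol_iff.2 (by omega)))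

/-- The accepted word is the whole convolution of a pair in `S`, and `z` has ended at column `h`.
Hence the first half of the pair is `z` itself, and the second half is what the tape now holds. The
mark on the first cell is present because `0 < h`. -/
theorem exists_of_sweep_end (hD : D.accepts = conv '' S) {z : J → List Γ} {u : ℕ → J → Option Γ}
    {h : ℕ} (hh : 0 < h) (hb : col z h = blankCol) (hacc : D.eval (sweepWord z u h) ∈ D.accept) :
    ∃ z', Sum.elim z z' ∈ S ∧ midTape z u h = sweepTape true z' := by
  obtain ⟨y, y', hy, e⟩ := exists_conv_eq_of_eval_mem hD hacc
  have hlen : h = maxLen (Sum.elim y y') := by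
    simpa [sweepWord] using congrArg List.length e
  have hcol : ∀ i < h, col z i = col y i ∧ u i = col y' i := fun i hi =>
    col_eq_of_sweepWord_append (v := []) (by simpa using e) hi
  have hend : ∀ i, h ≤ i → col y i = blankCol ∧ col y' i = blankCol := fun i hi => by
    have := col_eq_blankCol_iff.2 (hlen ▸ hi)
    rw [col_sumElim] at this
    exact ⟨funext fun j => congrFun this (.inl j), funext fun j => congrFun this (.inr j)⟩
  have hz : ∀ i, h ≤ i → col z i = blankCol := fun i hi =>
    col_eq_blankCol_iff.2 ((col_eq_blankCol_iff.1 hb).trans hi)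
  have hzy : z = y := col_injective (funext fun i => by
    by_cases hi : i < h
    · exact (hcol i hi).1
    · rw [hz i (not_lt.1 hi), (hend i (not_lt.1 hi)).1])
  refine ⟨y', hzy ▸ hy, funext fun i => ?_⟩
  by_cases hi : i < h
  · simp [midTape, sweepTape, hi, (hcol i hi).2]
  · simp only [midTape, sweepTape, hi, if_false, hz i (not_lt.1 hi), (hend i (not_lt.1 hi)).2]
    simp
    omega

/-! ### Invariant, running time and completeness of the sweeping machine -/

variable {A : Type*} [Finite Γ] [Finite σ] {incl : A ↪ Γ} {inp : J} {acc : Set (J → Option Γ)}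

theorem sweepNTM_init (x : List A) :
    (sweepNTM incl inp D acc).init x =
      ⟨.sweep true D.start, 0, sweepTape false (singleTuple inp (x.map incl))⟩ := by
  unfold NTM.init
  congr 1
  funext i
  rw [List.getD_eq_getElem?_getD]
  simp only [sweepTape, col_singleTuple, Bool.false_and, List.getElem?_map]
  cases x[i]? <;> rfl

/-- The configurations that a sweeping machine reaches in at most `t` steps from the tuple `z₀`, if
no tuple that occurs is longer than `H`. -/
inductive SweepInv (incl : A ↪ Γ) (inp : J) (D : DFA (J ⊕ J → Option Γ) σ)
    (acc : Set (J → Option Γ)) (S : Set (J ⊕ J → List Γ)) (z₀ : J → List Γ) (H : ℕ) :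
    ℕ → (sweepNTM incl inp D acc).Cfg → Prop
  | start (t s : ℕ) (z : J → List Γ) (b : Bool)
      (hs : StepsTo (fun z z' => Sum.elim z z' ∈ S) s z₀ z) (ht : t ≤ s * (2 * H + 1)) :
      SweepInv incl inp D acc S z₀ H t ⟨.sweep true D.start, 0, sweepTape b z⟩
  | sweep (t s : ℕ) (z : J → List Γ) (u : ℕ → J → Option Γ) (h : ℕ)
      (hs : StepsTo (fun z z' => Sum.elim z z' ∈ S) s z₀ z) (hh : 0 < h)
      (hne : ∀ i < h, col z i ≠ blankCol ∨ u i ≠ blankCol)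
      (hco : ∃ v, D.evalFrom (D.eval (sweepWord z u h)) v ∈ D.accept)
      (ht : t ≤ s * (2 * H + 1) + h) :
      SweepInv incl inp D acc S z₀ H t
        ⟨.sweep false (D.eval (sweepWord z u h)), h, midTape z u h⟩
  | back (t s : ℕ) (z : J → List Γ) (h : ℕ)
      (hs : StepsTo (fun z z' => Sum.elim z z' ∈ S) (s + 1) z₀ z)
      (ht : t + h ≤ s * (2 * H + 1) + 2 * H) :
      SweepInv incl inp D acc S z₀ H t ⟨.back, h, sweepTape true z⟩
  | accept (t s : ℕ) (z : J → List Γ)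
      (hs : StepsTo (fun z z' => Sum.elim z z' ∈ S) (s + 1) z₀ z) (h : col z 0 ∈ acc)
      (ht : t ≤ (s + 1) * (2 * H + 1)) :
      SweepInv incl inp D acc S z₀ H t ⟨.accept, 0, sweepTape true z⟩

/-- The constant `2 * H + 1` pays for one round: at most `H` moves to the right, as many to the left
including the turn, and one step on the marked cell to restart or accept. -/
theorem SweepInv.step (hD : D.accepts = conv '' S) {z₀ : J → List Γ} {c H : ℕ}
    (hc : ∀ z z', Sum.elim z z' ∈ S → maxLen z' ≤ maxLen z + c)
    (hH : ∀ s z, StepsTo (fun z z' => Sum.elim z z' ∈ S) s z₀ z → maxLen z + c ≤ H)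
    {t : ℕ} {C C' : (sweepNTM incl inp D acc).Cfg} (hC : SweepInv incl inp D acc S z₀ H t C)
    (hstep : (sweepNTM incl inp D acc).Step C C') : SweepInv incl inp D acc S z₀ H (t + 1) C' := by
  obtain ⟨hna, -, q, a, m, hδ, rfl⟩ := hstep
  cases hC with
  | start s z b hs ht =>
    change SweepAct D acc (.sweep true D.start) (b && true, col z 0) (q, a, m) at hδ
    cases hδ with
    | letter _ _ _ _ n hne hco =>
      have h1 : D.eval (sweepWord z (fun _ => n) 1) = D.step D.start (Sum.elim (col z 0) n) := rfl
      have := SweepInv.sweep (incl := incl) (inp := inp) (acc := acc) (H := H) (t + 1) s z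
        (fun _ => n) 1 hs one_pos (fun i hi => by rwa [Nat.lt_one_iff.1 hi]) hco (by omega)
      rw [← update_sweepTape_zero b, h1] at this
      exact this
  | sweep s z u h hs hh hne hco ht =>
    have hδ' : SweepAct D acc (.sweep false (D.eval (sweepWord z u h))) (false, col z h)
        (q, a, m) := by
      have : midTape z u h h = (false, col z h) := by simp [midTape]
      rw [← this]
      exact hδ
    clear hδ
    generalize ho : col z h = o at hδ'
    cases hδ' with
    | letter _ _ _ _ n hne' hco' =>
      subst ho
      have h0 : sweepWord z (Function.update u h n) h = sweepWord z u h :=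
        sweepWord_congr fun i hi => by simp [hi.ne]
      have h1 : D.eval (sweepWord z (Function.update u h n) (h + 1)) =
          D.step (D.eval (sweepWord z u h)) (Sum.elim (col z h) n) := by
        rw [sweepWord_succ, DFA.eval_append_singleton, h0, Function.update_self]
      have := SweepInv.sweep (incl := incl) (inp := inp) (acc := acc) (H := H) (t + 1) s z
        (Function.update u h n) (h + 1) hs (by omega) (fun i hi => by
          rcases Nat.lt_succ_iff_lt_or_eq.1 hi with hi | rfl
          · simpa [hi.ne] using hne i hi
          · simpa using hne') (by rwa [h1]) (by omega)
      rw [← update_midTape hh, h1] at this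
      exact this
    | turn _ _ hacc =>
      obtain ⟨z', hz', e⟩ := exists_of_sweep_end hD hh ho hacc
      have hle := (sweep_length_le hD hc hne hco).trans (hH s z hs)
      have := SweepInv.back (incl := incl) (inp := inp) (D := D) (acc := acc) (H := H) (t + 1) s z'
        (h - 1) (hs.succ hz') (by omega)
      rw [← e] at this
      have e2 : Function.update (midTape z u h) h (false, blankCol) = midTape z u h := by
        rw [Function.update_eq_self_iff]
        simp [midTape, ho]
      rw [← e2] at this
      exact this
  | back s z h hs ht =>
    have hδ' : SweepAct D acc .back (h == 0, col z h) (q, a, m) := by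
      have : sweepTape true z h = (h == 0, col z h) := by simp [sweepTape]
      rw [← this]
      exact hδ
    clear hδ
    have e2 : Function.update (sweepTape true z) h (h == 0, col z h) = sweepTape true z := by
      rw [Function.update_eq_self_iff]
      simp [sweepTape]
    rcases h with _ | h
    · cases hδ' with
      | restart =>
        have := SweepInv.start (incl := incl) (inp := inp) (D := D) (acc := acc) (H := H) (t + 1)
          (s + 1) z true hs (by rw [add_mul]; omega)
        rw [← e2] at this
        exact this
      | accept _ h =>
        have := SweepInv.accept (incl := incl) (inp := inp) (D := D) (acc := acc) (H := H) (t + 1)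
          s z hs h (by rw [add_mul]; omega)
        rw [← e2] at this
        exact this
    · cases hδ' with
      | back =>
        have := SweepInv.back (incl := incl) (inp := inp) (D := D) (acc := acc) (H := H) (t + 1) s z
          h hs (by omega)
        rw [← e2] at this
        exact this
  | accept => exact absurd rfl hna

theorem SweepInv.of_stepsTo (hD : D.accepts = conv '' S) {x : List A} {c H : ℕ}
    (hc : ∀ z z', Sum.elim z z' ∈ S → maxLen z' ≤ maxLen z + c)
    (hH : ∀ s z, StepsTo (fun z z' => Sum.elim z z' ∈ S) s (singleTuple inp (x.map incl)) z →
      maxLen z + c ≤ H)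
    {t : ℕ} {C : (sweepNTM incl inp D acc).Cfg}
    (h : StepsTo (sweepNTM incl inp D acc).Step t ((sweepNTM incl inp D acc).init x) C) :
    SweepInv incl inp D acc S (singleTuple inp (x.map incl)) H t C := by
  generalize hC : (sweepNTM incl inp D acc).init x = C₀ at h
  induction h with
  | zero =>
    rw [← hC, sweepNTM_init]
    exact .start 0 0 _ false (.zero _) (Nat.zero_le _)
  | succ _ hr ih => exact (ih hC).step hD hc hH hr

theorem SweepInv.le {z₀ : J → List Γ} {H T t : ℕ} {C : (sweepNTM incl inp D acc).Cfg} {c : ℕ}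
    (hD : D.accepts = conv '' S)
    (hc : ∀ z z', Sum.elim z z' ∈ S → maxLen z' ≤ maxLen z + c)
    (hH : ∀ s z, StepsTo (fun z z' => Sum.elim z z' ∈ S) s z₀ z → maxLen z + c ≤ H)
    (hT : ∀ s z, StepsTo (fun z z' => Sum.elim z z' ∈ S) s z₀ z → s ≤ T)
    (h : SweepInv incl inp D acc S z₀ H t C) : t ≤ (T + 1) * (2 * H + 1) := by
  have mono : ∀ s, s ≤ T → s * (2 * H + 1) ≤ T * (2 * H + 1) := fun s hs =>
    Nat.mul_le_mul_right _ hs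
  rw [add_mul]
  cases h with
  | start s z b hs ht =>
    have := mono s (hT s z hs)
    omega
  | sweep s z u h hs hh hne hco ht =>
    have := mono s (hT s z hs)
    have := (sweep_length_le hD hc hne hco).trans (hH s z hs)
    omega
  | back s z h hs ht =>
    have := mono s ((Nat.le_succ s).trans (hT _ z hs))
    omega
  | accept s z hs h ht =>
    have := mono (s + 1) (hT _ z hs)
    omega

/-- The machine guesses the columns of `z'`. By `hz'`, at least one column is read, as it must be,
since turning is impossible before the first cell has been marked. -/
theorem sweep_reaches_back (hD : D.accepts = conv '' S) {z z' : J → List Γ}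
    (h : Sum.elim z z' ∈ S) (hz' : col z' 0 ≠ blankCol) (b : Bool) :
    Relation.ReflTransGen (sweepNTM incl inp D acc).Step
      ⟨.sweep true D.start, 0, sweepTape b z⟩ ⟨.back, 0, sweepTape true z'⟩ := by
  set m := maxLen (Sum.elim z z') with hm
  have hmem : D.eval (sweepWord z (col z') m) ∈ D.accept := by
    have : conv (Sum.elim z z') ∈ D.accepts := by
      rw [hD]
      exact ⟨_, h, rfl⟩
    rwa [conv_sumElim] at this
  have hmpos : 0 < m := by
    by_contra h0
    have h1 : col (Sum.elim z z') 0 = blankCol := col_eq_blankCol_iff.2 (by omega)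
    rw [col_sumElim] at h1
    exact hz' (funext fun j => congrFun h1 (.inr j))
  have hne : ∀ i < m, col z i ≠ blankCol ∨ col z' i ≠ blankCol := by
    intro i hi
    by_contra! h0
    refine hi.not_ge (col_eq_blankCol_iff.1 ?_)
    rw [col_sumElim, h0.1, h0.2]
    funext j
    rcases j with j | j <;> rfl
  have hco : ∀ i < m, ∃ v, D.evalFrom (D.step (D.eval (sweepWord z (col z') i))
      (Sum.elim (col z i) (col z' i))) v ∈ D.accept := by
    intro i hi
    rw [← DFA.eval_append_singleton, ← sweepWord_succ]
    -- The rest of the correct word shows that acceptance is still reachable.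
    refine ⟨(sweepWord z (col z') m).drop (i + 1), ?_⟩
    rw [DFA.eval, ← DFA.evalFrom_of_append]
    have : sweepWord z (col z') (i + 1) = (sweepWord z (col z') m).take (i + 1) := by
      rw [sweepWord, sweepWord, ← List.map_take, List.take_range, min_eq_left (by omega)]
    rw [this, List.take_append_drop]
    exact hmem
  have hfwd : ∀ i < m, Relation.ReflTransGen (sweepNTM incl inp D acc).Step
      ⟨.sweep true D.start, 0, sweepTape b z⟩
      ⟨.sweep false (D.eval (sweepWord z (col z') (i + 1))), i + 1, midTape z (col z') (i + 1)⟩ := by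
    intro i hi
    induction i with
    | zero =>
      refine .single ⟨by simp [sweepNTM], by simp [sweepNTM], _, _, _,
        SweepAct.letter true D.start _ (col z 0) (col z' 0) (hne 0 hi) (hco 0 hi), ?_⟩
      have : midTape z (col z') 1 = midTape z (fun _ => col z' 0) 1 := by
        funext i
        rcases i with _ | i <;> simp [midTape]
      rw [this, ← update_sweepTape_zero b]
      rfl
    | succ i ih =>
      have hact : SweepAct D acc (.sweep false (D.eval (sweepWord z (col z') (i + 1))))
          (midTape z (col z') (i + 1) (i + 1)) (.sweep false (D.step (D.eval (sweepWord z (col z')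
            (i + 1))) (Sum.elim (col z (i + 1)) (col z' (i + 1)))), (false, col z' (i + 1)), .right) := by
        have : midTape z (col z') (i + 1) (i + 1) = (false, col z (i + 1)) := by simp [midTape]
        rw [this]
        exact .letter false _ _ (col z (i + 1)) (col z' (i + 1)) (hne _ hi) (hco _ hi)
      refine (ih (by omega)).tail ⟨by simp [sweepNTM], by simp [sweepNTM], _, _, _, hact, ?_⟩
      have := update_midTape (Nat.succ_pos i) z (col z') (col z' (i + 1))
      rw [Function.update_eq_self] at this
      rw [← this, sweepWord_succ z _ (i + 1), DFA.eval_append_singleton]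
      rfl
  have hback : ∀ i, Relation.ReflTransGen (sweepNTM incl inp D acc).Step
      ⟨.back, i, sweepTape true z'⟩ ⟨.back, 0, sweepTape true z'⟩ := by
    intro i
    induction i with
    | zero => rfl
    | succ i ih =>
      refine .head ⟨by simp [sweepNTM], by simp [sweepNTM], _, _, _,
        SweepAct.back (col z' (i + 1)), ?_⟩ ih
      have : Function.update (sweepTape true z') (i + 1) (false, col z' (i + 1)) =
          sweepTape true z' := by
        rw [Function.update_eq_self_iff]
        simp [sweepTape]
      exact congrArg _ this.symm
  have hblank : col z m = blankCol := by
    rw [col_eq_blankCol_iff]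
    exact maxLen_le_iff.2 fun j => length_le_maxLen (Sum.elim z z') (.inl j)
  obtain ⟨z'', h'', e⟩ := exists_of_sweep_end hD hmpos hblank hmem
  -- Behind column `m` both `z` and `z'` are empty, so the tape left by the sweep is that of `z'`.
  have hz'' : sweepTape true z'' = sweepTape true z' := by
    rw [← e]
    funext i
    have hend : m ≤ i → col z i = blankCol ∧ col z' i = blankCol := fun hi => by
      have := col_eq_blankCol_iff.2 (hm ▸ hi)
      rw [col_sumElim] at this
      exact ⟨funext fun j => congrFun this (.inl j), funext fun j => congrFun this (.inr j)⟩
    by_cases hi : i < m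
    · simp [midTape, sweepTape, hi]
    · simp only [midTape, sweepTape, hi, if_false, (hend (not_lt.1 hi)).1,
        (hend (not_lt.1 hi)).2]
      simp
      omega
  have hlast := hfwd (m - 1) (by omega)
  rw [Nat.sub_add_cancel hmpos] at hlast
  have hact : SweepAct D acc (.sweep false (D.eval (sweepWord z (col z') m)))
      (midTape z (col z') m m) (.back, (false, blankCol), .left) := by
    have : midTape z (col z') m m = (false, blankCol) := by simp [midTape, hblank]
    rw [this]
    exact .turn _ _ hmem
  have hupd : Function.update (midTape z (col z') m) m (false, blankCol) = sweepTape true z' := by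
    rw [← hz'', ← e, Function.update_eq_self_iff]
    simp [midTape, hblank]
  exact (hlast.tail (c := ⟨SweepState.back, m - 1, sweepTape true z'⟩) ⟨by simp [sweepNTM],
    by simp [sweepNTM], _, _, _, hact, congrArg _ hupd.symm⟩).trans (hback _)

theorem sweep_reaches_start (hD : D.accepts = conv '' S)
    (hne : ∀ z z', Sum.elim z z' ∈ S → col z' 0 ≠ blankCol) {s : ℕ} {z₀ z : J → List Γ}
    (h : StepsTo (fun z z' => Sum.elim z z' ∈ S) s z₀ z) (b : Bool) :
    ∃ b', Relation.ReflTransGen (sweepNTM incl inp D acc).Step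
      ⟨.sweep true D.start, 0, sweepTape b z₀⟩ ⟨.sweep true D.start, 0, sweepTape b' z⟩ := by
  induction h with
  | zero => exact ⟨b, .refl⟩
  | succ _ hr ih =>
    obtain ⟨b', hb'⟩ := ih
    refine ⟨true, (hb'.trans (sweep_reaches_back hD hr (hne _ _ hr) b')).tail
      ⟨by simp [sweepNTM], by simp [sweepNTM], _, _, _, SweepAct.restart _, ?_⟩⟩
    exact congrArg _ (Function.update_eq_self 0 _).symm

/-- A language is in `NP` if it is given by polynomially long paths of an automatic relation between
tuples of strings of which the lengths increase by at most a constant. -/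
theorem mem_NP_of_iterate {L : Language A} (hS : IsAutomatic S) {c : ℕ}
    (hc : ∀ z z', Sum.elim z z' ∈ S → maxLen z' ≤ maxLen z + c)
    (hne : ∀ z z', Sum.elim z z' ∈ S → col z' 0 ≠ blankCol) {C k : ℕ}
    (hT : ∀ (x : List A) (s : ℕ) (z : J → List Γ), StepsTo (fun z z' => Sum.elim z z' ∈ S) s
      (singleTuple inp (x.map incl)) z → s ≤ C * (x.length + 1) ^ k)
    (hL : ∀ x, x ∈ L ↔ ∃ s z, StepsTo (fun z z' => Sum.elim z z' ∈ S) (s + 1)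
      (singleTuple inp (x.map incl)) z ∧ col z 0 ∈ acc) : L ∈ NP A := by
  obtain ⟨σ, _, D, hD⟩ := hS
  have hlen : ∀ (x : List A) (s : ℕ) (z : J → List Γ), StepsTo (fun z z' => Sum.elim z z' ∈ S) s
      (singleTuple inp (x.map incl)) z → maxLen z ≤ x.length + c * s := by
    intro x s z h
    generalize hz₀ : singleTuple inp (x.map incl) = z₀ at h
    induction h with
    | zero =>
      rw [← hz₀, maxLen_le_iff]
      intro j
      by_cases hj : j = inp
      · simp [hj, singleTuple_self]
      · simp [singleTuple_of_ne hj]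
    | succ _ hr ih =>
      have := hc _ _ hr
      have := ih hz₀
      rw [mul_add]
      omega
  set T : ℕ → ℕ := fun n => C * (n + 1) ^ k with hTdef
  -- After at most `T n` applications the strings have length at most `n + c * T n`; a sweep may go
  -- `c` cells further.
  set H : ℕ → ℕ := fun n => n + c * T n + c with hHdef
  have hH : ∀ (x : List A) (s : ℕ) (z : J → List Γ), StepsTo (fun z z' => Sum.elim z z' ∈ S) s
      (singleTuple inp (x.map incl)) z → maxLen z + c ≤ H x.length := fun x s z h => by
    have h1 := hlen x s z h
    have h2 := Nat.mul_le_mul_left c (hT x s z h)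
    simp only [hHdef, hTdef]
    omega
  -- The number of rounds has degree `k`; the length of a round has degree at most `k + 1`, which
  -- also covers the summand `n` when `k = 0`.
  refine Set.mem_iUnion.2 ⟨k + (k + 1), sweepNTM incl inp D acc, fun x => ?_,
    fun n => (T n + 1) * (2 * H n + 1), ?_, fun x t C h =>
      (SweepInv.of_stepsTo hD hc (hH x) h).le hD hc (hH x) (hT x)⟩
  · rw [hL]
    constructor
    · rintro ⟨s, z, h, hz⟩
      cases h with
      | succ h hr =>
        obtain ⟨b, hb⟩ := sweep_reaches_start (incl := incl) (inp := inp) (acc := acc) hD hne h false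
        have hreach := (hb.trans (sweep_reaches_back hD hr (hne _ _ hr) b)).tail
          (c := ⟨SweepState.accept, 0, sweepTape true z⟩)
          ⟨by simp [sweepNTM], by simp [sweepNTM], _, _, _, SweepAct.accept _ hz,
            congrArg _ (Function.update_eq_self 0 _).symm⟩
        obtain ⟨t, ht⟩ := exists_stepsTo_iff.2 hreach
        rw [← sweepNTM_init] at ht
        exact ⟨t, _, ht, rfl⟩
    · rintro ⟨t, Cf, h, hacc⟩
      cases SweepInv.of_stepsTo hD hc (hH x) h with
      | accept s z hs hz ht => exact ⟨s, z, hs, hz⟩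
      | start | sweep | back => cases hacc
  · refine isBigO_pow_of_le (C := (C + 1) * (3 + 2 * c * C + 2 * c)) fun n => ?_
    have h1 : 1 ≤ (n + 1) ^ k := Nat.one_le_pow _ _ (by omega)
    have h2 : T n + 1 ≤ (C + 1) * (n + 1) ^ k := by
      simp only [hTdef]
      nlinarith
    have h3 : 2 * H n + 1 ≤ (3 + 2 * c * C + 2 * c) * (n + 1) ^ (k + 1) := by
      have h4 : n + 1 ≤ (n + 1) ^ (k + 1) := by
        rw [pow_succ]
        nlinarith
      have h5 : (n + 1) ^ k ≤ (n + 1) ^ (k + 1) := Nat.pow_le_pow_right (by omega) (by omega)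
      have h6 : c * (C * (n + 1) ^ k) ≤ c * (C * (n + 1) ^ (k + 1)) := by gcongr
      have h7 : c * 1 ≤ c * (n + 1) ^ (k + 1) := by gcongr; omega
      simp only [hHdef, hTdef]
      nlinarith
    calc (T n + 1) * (2 * H n + 1)
        ≤ ((C + 1) * (n + 1) ^ k) * ((3 + 2 * c * C + 2 * c) * (n + 1) ^ (k + 1)) :=
          Nat.mul_le_mul h2 h3
      _ = (C + 1) * (3 + 2 * c * C + 2 * c) * (n + 1) ^ (k + (k + 1)) := by ring

end Sweep

/-! ### Register machines in polynomial time are simulated by Turing machines -/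

section Simulation

/-- The strings that represent a configuration of a register machine and a clock: the input, the
registers, the digits of the clock, the number of the line, and a flag for acceptance. -/
inductive Track (r K : ℕ)
  | input
  | reg (i : Fin r)
  | clock (i : Fin K)
  | line
  | flag

instance finite_track (r K : ℕ) : Finite (Track r K) :=
  Finite.of_surjective
    (fun s : (Fin r ⊕ Fin K) ⊕ Fin 3 => match s with
      | .inl (.inl i) => Track.reg i
      | .inl (.inr i) => .clock i
      | .inr 0 => .input
      | .inr 1 => .line
      | .inr 2 => .flag)
    (by
      rintro (_ | i | i | _ | _)
      · exact ⟨.inr 0, rfl⟩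
      · exact ⟨.inl (.inl i), rfl⟩
      · exact ⟨.inl (.inr i), rfl⟩
      · exact ⟨.inr 1, rfl⟩
      · exact ⟨.inr 2, rfl⟩)

noncomputable instance fintypeTrack (r K : ℕ) : Fintype (Track r K) := Fintype.ofFinite _

/-- The vectors of `K` digits less than `B`, numbered in lexicographic order. -/
theorem exists_lex_equiv (K B : ℕ) : ∃ e : (Fin K → Fin B) ≃ Fin (B ^ K),
    ∀ v w, e v < e w ↔ ∃ i, (∀ j < i, v j = w j) ∧ v i < w i := by
  have := Fintype.ofFinite (Lex (Fin K → Fin B))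
  have hcard : Fintype.card (Lex (Fin K → Fin B)) = B ^ K := by
    rw [Fintype.card_congr (ofLex (α := Fin K → Fin B))]
    simp
  let f := (Fintype.orderIsoFinOfCardEq (Lex (Fin K → Fin B)) hcard).symm
  exact ⟨toLex.trans f.toEquiv, fun v w => f.lt_iff_lt⟩

variable {A : Type*} {M : ARM A} {K : ℕ}

/-- The contents of the registers. -/
def regs {Γ : Type} {r : ℕ} (z : Track r K → List Γ) : Fin r → List Γ := fun i => z (.reg i)

/-- `z` represents a configuration with line `l` and register contents `ρ`. -/
def Holds {Γ : Type} {r : ℕ} (γ : Γ) (z : Track r K → List Γ) (l : ℕ) (ρ : Fin r → List Γ) :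
    Prop :=
  regs z = ρ ∧ z .line = List.replicate (l + 1) γ ∧ z .flag = []

/-- The effect of an instruction in line `l` on the strings that represent a configuration. -/
def SimPerform (γ : M.Γ) (l : ℕ) (z z' : Track M.numReg K → List M.Γ) :
    Instr A (Fin M.numReg) M.Op M.Test M.arity M.testArity → Prop
  | .read i => Holds γ z' (l + 1) (Function.update (regs z) i (z .input))
  | .write _ => Holds γ z' (l + 1) (regs z)
  | .const i w => Holds γ z' (l + 1) (Function.update (regs z) i (w.map M.incl))
  | .copy i j => Holds γ z' (l + 1) (Function.update (regs z) i (regs z j))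
  | .apply i F p => ∃ y, M.op F (fun k => regs z (p k)) y ∧
      Holds γ z' (l + 1) (Function.update (regs z) i y)
  | .goto l' => Holds γ z' l' (regs z)
  | .ifGoto F p l' =>
      ((fun k => regs z (p k)) ∈ M.test F ∧ Holds γ z' l' (regs z)) ∨
      ((fun k => regs z (p k)) ∉ M.test F ∧ Holds γ z' (l + 1) (regs z))
  | .halt => False
  | .haltAccept => regs z' = regs z ∧ z' .line = [] ∧ z' .flag = [γ]
  | .haltReject => False

/-- The digits of the clock decrease in the lexicographic order; they are bounded by the length of
the input. -/
def ClockLt {Γ : Type} {r : ℕ} (z z' : Track r K → List Γ) : Prop :=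
  (∀ i, (z' (.clock i)).length ≤ (z .input).length + 1) ∧
    ∃ i, (∀ j < i, (z' (.clock j)).length = (z (.clock j)).length) ∧
      (z' (.clock i)).length < (z (.clock i)).length

/-- The effect of one step on the strings that represent a configuration; a first step sets the
clock. -/
def SimStep (γ : M.Γ) (z z' : Track M.numReg K → List M.Γ) : Prop :=
  z' .input = z .input ∧ z .flag = [] ∧
    ((z .line = [] ∧ (∀ i, (z' (.clock i)).length ≤ (z .input).length + 1) ∧
        Holds γ z' 0 fun _ => []) ∨
      ∃ l : Fin M.program.length, z .line = List.replicate (l + 1) γ ∧ ClockLt z z' ∧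
        SimPerform γ l z z' M.program[l])

/-! #### Automaticity -/

section Automaticity

theorem recognizable_holds_of (γ : M.Γ) (l : ℕ)
    {ρ : (Track M.numReg K ⊕ Track M.numReg K → List M.Γ) → Fin M.numReg → List M.Γ}
    (hρ : ∀ i, Recognizable fun y : Track M.numReg K ⊕ Track M.numReg K → List M.Γ =>
      y (Sum.inr (Track.reg i)) = ρ y i) :
    Recognizable fun y : Track M.numReg K ⊕ Track M.numReg K → List M.Γ =>
      Holds γ (y ∘ Sum.inr) l (ρ y) := by
  refine ((Recognizable.forall_finite hρ).and ((Recognizable.eq_const (Sum.inr Track.line)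
    (List.replicate (l + 1) γ)).and (Recognizable.eq_const (Sum.inr Track.flag) []))).congr fun y => ?_
  exact and_congr_left' funext_iff

variable [Finite M.Γ]

theorem recognizable_holds (γ : M.Γ) (l : ℕ) :
    Recognizable fun y : Track M.numReg K ⊕ Track M.numReg K → List M.Γ =>
      Holds γ (y ∘ Sum.inr) l (regs (y ∘ Sum.inl)) :=
  recognizable_holds_of γ l fun i => Recognizable.eq (Sum.inr (Track.reg i)) (Sum.inl (Track.reg i))

theorem recognizable_holds_update (γ : M.Γ) (l : ℕ) (i : Fin M.numReg)
    {v : (Track M.numReg K ⊕ Track M.numReg K → List M.Γ) → List M.Γ}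
    (hv : Recognizable fun y : Track M.numReg K ⊕ Track M.numReg K → List M.Γ =>
      y (Sum.inr (Track.reg i)) = v y) :
    Recognizable fun y : Track M.numReg K ⊕ Track M.numReg K → List M.Γ =>
      Holds γ (y ∘ Sum.inr) l (Function.update (regs (y ∘ Sum.inl)) i (v y)) := by
  refine recognizable_holds_of γ l fun j => ?_
  by_cases hj : j = i
  · subst hj
    simpa using hv
  · exact (Recognizable.eq (Sum.inr (Track.reg j)) (Sum.inl (Track.reg j))).congr fun y => by
      simp [hj, regs]

theorem recognizable_simPerform (γ : M.Γ) (l : ℕ)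
    (I : Instr A (Fin M.numReg) M.Op M.Test M.arity M.testArity) :
    Recognizable fun y : Track M.numReg K ⊕ Track M.numReg K → List M.Γ =>
      SimPerform γ l (y ∘ Sum.inl) (y ∘ Sum.inr) I := by
  have htest : ∀ (F : M.Test) (p : Fin (M.testArity F) → Fin M.numReg),
      Recognizable fun y : Track M.numReg K ⊕ Track M.numReg K → List M.Γ =>
        (fun k => regs (y ∘ Sum.inl) (p k)) ∈ M.test F := fun F p =>
    (M.test_automatic F).recognizable.comap (κ := Track M.numReg K ⊕ Track M.numReg K)
      fun k => Sum.inl (Track.reg (p k))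
  cases I with
  | read i => exact recognizable_holds_update γ _ i (.eq _ (Sum.inl Track.input))
  | write _ => exact recognizable_holds γ _
  | const i w => exact recognizable_holds_update γ _ i (.eq_const _ _)
  | copy i j => exact recognizable_holds_update γ _ i (.eq _ (Sum.inl (Track.reg j)))
  | apply i F p =>
    have hop := (M.op_automatic F).recognizable.comap (κ := Track M.numReg K ⊕ Track M.numReg K)
      fun k => k.elim (Sum.inr (Track.reg i)) fun k => Sum.inl (Track.reg (p k))
    -- No projection is needed for the existential quantifier: the result of the operation is the
    -- new content of register `i`, which is on a track of its own.
    refine (hop.and (recognizable_holds_update γ (l + 1) i (v := fun y => y (Sum.inr (Track.reg i)))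
      ((Recognizable.const True).congr fun _ => by simp))).congr fun y => ?_
    constructor
    · rintro ⟨v, hv, h⟩
      have : v = y (Sum.inr (Track.reg i)) := by
        simpa [regs] using (congrFun h.1 i).symm
      subst this
      exact ⟨hv, h⟩
    · rintro ⟨hv, h⟩
      exact ⟨_, hv, h⟩
  | goto l' => exact recognizable_holds γ _
  | ifGoto F p l' =>
    exact ((htest F p).and (recognizable_holds γ _)).or
      ((htest F p).not.and (recognizable_holds γ _))
  | halt => exact .const False
  | haltAccept =>
    refine ((Recognizable.forall_finite fun i : Fin M.numReg =>
        Recognizable.eq (Sum.inr (Track.reg i)) (Sum.inl (Track.reg i))).and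
      ((Recognizable.eq_const (Sum.inr Track.line) []).and
        (Recognizable.eq_const (Sum.inr Track.flag) [γ]))).congr fun y => ?_
    exact and_congr_left' funext_iff
  | haltReject => exact .const False

theorem recognizable_clockLt {Γ : Type} [Finite Γ] {r : ℕ} :
    Recognizable fun y : Track r K ⊕ Track r K → List Γ => ClockLt (y ∘ Sum.inl) (y ∘ Sum.inr) := by
  refine .and (.forall_finite fun i => .length_le_succ (Sum.inr (Track.clock i)) (Sum.inl Track.input))
    (.exists_finite fun i => .and (.forall_finite fun j => ?_)
      (.length_lt (Sum.inr (Track.clock i)) (Sum.inl (Track.clock i))))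
  by_cases hj : j < i
  · exact ((Recognizable.length_le (Sum.inr (Track.clock j)) (Sum.inl (Track.clock j))).and
      (Recognizable.length_le (Sum.inl (Track.clock j)) (Sum.inr (Track.clock j)))).congr fun y => by
        simp [hj, le_antisymm_iff]
  · exact (Recognizable.const True).congr fun y => by simp [hj]

theorem isAutomatic_simStep (γ : M.Γ) :
    IsAutomatic {y : Track M.numReg K ⊕ Track M.numReg K → List M.Γ |
      SimStep γ (y ∘ Sum.inl) (y ∘ Sum.inr)} := by
  have hinit : Recognizable fun y : Track M.numReg K ⊕ Track M.numReg K → List M.Γ =>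
      Holds γ (y ∘ Sum.inr) 0 fun _ => [] :=
    recognizable_holds_of γ 0 fun i => .eq_const (Sum.inr (Track.reg i)) []
  have hstep : Recognizable fun y : Track M.numReg K ⊕ Track M.numReg K → List M.Γ =>
      ∃ l : Fin M.program.length, y (Sum.inl Track.line) = List.replicate (l + 1) γ ∧
        ClockLt (y ∘ Sum.inl) (y ∘ Sum.inr) ∧
          SimPerform γ l (y ∘ Sum.inl) (y ∘ Sum.inr) M.program[l] :=
    .exists_finite fun l => .and (.eq_const (Sum.inl Track.line) _)
      (recognizable_clockLt.and (recognizable_simPerform γ _ _))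
  exact Recognizable.isAutomatic (.and (.eq (Sum.inr Track.input) (Sum.inl Track.input))
    (.and (.eq_const (Sum.inl Track.flag) []) (.or (.and (.eq_const (Sum.inl Track.line) [])
      (.and (.forall_finite fun i => .length_le_succ (Sum.inr (Track.clock i)) (Sum.inl Track.input))
        hinit)) hstep)))

end Automaticity

/-! #### Lengths -/

theorem Holds.length_le {Γ : Type} {r : ℕ} {γ : Γ} {z : Track r K → List Γ} {l m : ℕ}
    {ρ : Fin r → List Γ} (h : Holds γ z l ρ) (hρ : ∀ i, (ρ i).length ≤ m) (hl : l + 1 ≤ m) :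
    (∀ i, (z (.reg i)).length ≤ m) ∧ (z .line).length ≤ m ∧ (z .flag).length ≤ m := by
  obtain ⟨rfl, h2, h3⟩ := h
  exact ⟨hρ, by simpa [h2] using hl, by simp [h3]⟩

theorem length_update_le {r m : ℕ} {Γ : Type} {ρ : Fin r → List Γ} {i : Fin r} {v : List Γ}
    (hρ : ∀ j, (ρ j).length ≤ m) (hv : v.length ≤ m) (j : Fin r) :
    (Function.update ρ i v j).length ≤ m := by
  by_cases hj : j = i
  · subst hj
    simpa using hv
  · simpa [hj] using hρ j

theorem exists_simPerform_length_le (hM : M.IsNARM) (γ : M.Γ) (l : ℕ)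
    (I : Instr A (Fin M.numReg) M.Op M.Test M.arity M.testArity) :
    ∃ c, ∀ z z' : Track M.numReg K → List M.Γ, SimPerform γ l z z' I →
      (∀ i, (z' (.reg i)).length ≤ maxLen z + c) ∧ (z' .line).length ≤ maxLen z + c ∧
        (z' .flag).length ≤ maxLen z + c := by
  have hreg : ∀ (z : Track M.numReg K → List M.Γ) (c : ℕ) (i : Fin M.numReg),
      (regs z i).length ≤ maxLen z + c := fun z c i =>
    (length_le_maxLen z (.reg i)).trans (Nat.le_add_right _ _)
  cases I with
  | read i =>
    exact ⟨l + 2, fun z z' h => h.length_le (length_update_le (hreg z _)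
      ((length_le_maxLen z .input).trans (Nat.le_add_right _ _))) (by omega)⟩
  | write _ => exact ⟨l + 2, fun z z' h => h.length_le (hreg z _) (by omega)⟩
  | const i w =>
    exact ⟨l + 2 + w.length, fun z z' h => h.length_le (length_update_le (hreg z _)
      (by simp; omega)) (by omega)⟩
  | copy i j =>
    exact ⟨l + 2, fun z z' h => h.length_le (length_update_le (hreg z _) (hreg z _ j))
      (by omega)⟩
  | apply i F p =>
    obtain ⟨c, hc⟩ := hM F
    refine ⟨l + 2 + c, fun z z' ⟨v, hv, h⟩ => h.length_le (length_update_le (hreg z _) ?_)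
      (by omega)⟩
    have h1 := (hc _ _ hv).1
    have h2 : maxLen (fun k => regs z (p k)) ≤ maxLen z :=
      maxLen_le_iff.2 fun k => length_le_maxLen z (.reg (p k))
    omega
  | goto l' => exact ⟨l' + 1, fun z z' h => h.length_le (hreg z _) (by omega)⟩
  | ifGoto F p l' =>
    refine ⟨l + l' + 2, fun z z' h => ?_⟩
    rcases h with ⟨-, h⟩ | ⟨-, h⟩
    · exact h.length_le (hreg z _) (by omega)
    · exact h.length_le (hreg z _) (by omega)
  | halt => exact ⟨0, fun z z' h => h.elim⟩
  | haltAccept =>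
    refine ⟨1, fun z z' ⟨h1, h2, h3⟩ => ⟨fun i => ?_, by simp [h2], by simp [h3]⟩⟩
    have := hreg z 1 i
    rwa [← h1] at this
  | haltReject => exact ⟨0, fun z z' h => h.elim⟩

theorem exists_simStep_length_le (hM : M.IsNARM) (γ : M.Γ) :
    ∃ c, ∀ z z' : Track M.numReg K → List M.Γ, SimStep γ z z' → maxLen z' ≤ maxLen z + c := by
  choose c hc using fun l : Fin M.program.length =>
    exists_simPerform_length_le (K := K) hM γ l M.program[l]
  refine ⟨1 + ∑ l, c l, fun z z' ⟨hin, _, h⟩ => maxLen_le_iff.2 ?_⟩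
  have hinput := length_le_maxLen z .input
  have hclock : ∀ i, (z' (.clock i)).length ≤ (z .input).length + 1 := by
    rcases h with ⟨-, h, -⟩ | ⟨l, -, h, -⟩
    · exact h
    · exact h.1
  have hrest : (∀ i, (z' (.reg i)).length ≤ maxLen z + (1 + ∑ l, c l)) ∧
      (z' .line).length ≤ maxLen z + (1 + ∑ l, c l) ∧
        (z' .flag).length ≤ maxLen z + (1 + ∑ l, c l) := by
    rcases h with ⟨-, -, h⟩ | ⟨l, -, -, h⟩
    · exact h.length_le (by simp) (by omega)
    · obtain ⟨h1, h2, h3⟩ := hc l z z' h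
      have : c l ≤ ∑ l, c l := Finset.single_le_sum (fun _ _ => Nat.zero_le _) (Finset.mem_univ l)
      exact ⟨fun i => (h1 i).trans (by omega), by omega, by omega⟩
  rintro (_ | i | i | _ | _)
  · rw [hin]
    omega
  · exact hrest.1 i
  · have := hclock i
    omega
  · exact hrest.2.1
  · exact hrest.2.2

/-- Line `l` is stored with `l + 1` letters, so even line `0` is nonempty; the line track is emptied
only when the flag is raised. -/
theorem SimStep.col_ne_blankCol {γ : M.Γ} {z z' : Track M.numReg K → List M.Γ}
    (h : SimStep γ z z') : col z' 0 ≠ blankCol := by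
  have key : z' .line ≠ [] ∨ z' .flag ≠ [] := by
    have hh : ∀ {l ρ}, Holds γ z' l ρ → z' .line ≠ [] ∨ z' .flag ≠ [] := fun h => by
      left
      rw [h.2.1]
      simp
    obtain ⟨-, -, ⟨-, -, h⟩ | ⟨l, -, -, h⟩⟩ := h
    · exact hh h
    · generalize M.program[l] = I at h
      cases I with
      | read | write | const | copy | goto => exact hh h
      | apply => exact hh h.choose_spec.2
      | ifGoto => exact h.elim (fun h => hh h.2) fun h => hh h.2
      | halt | haltReject => exact h.elim
      | haltAccept => exact .inr (by simp [h.2.2])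
  intro e
  rw [col_eq_blankCol_iff, maxLen_le_iff] at e
  rcases key with h | h
  · exact h (List.length_eq_zero_iff.1 (Nat.le_zero.1 (e .line)))
  · exact h (List.length_eq_zero_iff.1 (Nat.le_zero.1 (e .flag)))

/-! #### Correctness -/

/-- The second alternative is needed because `halt_accept` has no successor configuration, whereas
the simulation spends a step on raising the flag. -/
theorem simPerform_iff {γ : M.Γ} {c : M.Cfg} {z z' : Track M.numReg K → List M.Γ} {x : List A}
    (hin : z .input = x.map M.incl) (hz : regs z = c.reg)
    (I : Instr A (Fin M.numReg) M.Op M.Test M.arity M.testArity) :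
    SimPerform γ c.line z z' I ↔ (∃ c', M.Perform x c I c' ∧ Holds γ z' c'.line c'.reg) ∨
      (I = .haltAccept ∧ regs z' = c.reg ∧ z' .line = [] ∧ z' .flag = [γ]) := by
  cases I <;> simp only [SimPerform, ARM.Perform, hin, hz, reduceCtorEq, false_and, or_false,
    exists_eq_left, exists_false, false_or, true_and]
  case apply i F p =>
    constructor
    · rintro ⟨y, hy, h⟩
      exact ⟨_, ⟨y, hy, rfl⟩, h⟩
    · rintro ⟨_, ⟨y, hy, rfl⟩, h⟩
      exact ⟨y, hy, h⟩
  case ifGoto F p l =>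
    constructor
    · rintro (⟨h1, h2⟩ | ⟨h1, h2⟩)
      · exact ⟨_, .inl ⟨h1, rfl⟩, h2⟩
      · exact ⟨_, .inr ⟨h1, rfl⟩, h2⟩
    · rintro ⟨_, ⟨h1, rfl⟩ | ⟨h1, rfl⟩, h2⟩
      · exact .inl ⟨h1, h2⟩
      · exact .inr ⟨h1, h2⟩

/-! ### The clock as a counter, and the simulation of whole paths -/

/-- What the clock shows: the number of the vector of the lengths of its digits. -/
def Shows {Γ : Type} {r B : ℕ} (e : (Fin K → Fin B) ≃ Fin (B ^ K)) (z : Track r K → List Γ)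
    (m : ℕ) : Prop :=
  ∃ v, (∀ i, (z (.clock i)).length = v i) ∧ (e v : ℕ) = m

theorem exists_shows {Γ : Type} {r n : ℕ} (e : (Fin K → Fin (n + 2)) ≃ Fin ((n + 2) ^ K))
    {z : Track r K → List Γ} (h : ∀ i, (z (.clock i)).length ≤ n + 1) :
    ∃ m < (n + 2) ^ K, Shows e z m :=
  ⟨_, (e fun i => ⟨(z (.clock i)).length, by have := h i; omega⟩).2, _, fun _ => rfl, rfl⟩

theorem Shows.of_clockLt {Γ : Type} {r n m : ℕ} {e : (Fin K → Fin (n + 2)) ≃ Fin ((n + 2) ^ K)}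
    (he : ∀ v w, e v < e w ↔ ∃ i, (∀ j < i, v j = w j) ∧ v i < w i)
    {z z' : Track r K → List Γ} (hz : Shows e z m) (hn : (z .input).length = n)
    (h : ClockLt z z') : ∃ m' < m, Shows e z' m' := by
  obtain ⟨v, hv, rfl⟩ := hz
  obtain ⟨h1, i, h2, h3⟩ := h
  rw [hn] at h1
  refine ⟨_, (he (fun i => ⟨(z' (.clock i)).length, by have := h1 i; omega⟩) v).2
    ⟨i, fun j hj => Fin.ext ((h2 j hj).trans (hv j)), ?_⟩, _, fun _ => rfl, rfl⟩
  rw [Fin.lt_def, ← hv]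
  exact h3

theorem clockLt_of_shows {Γ : Type} {r n m m' : ℕ}
    {e : (Fin K → Fin (n + 2)) ≃ Fin ((n + 2) ^ K)}
    (he : ∀ v w, e v < e w ↔ ∃ i, (∀ j < i, v j = w j) ∧ v i < w i)
    {z z' : Track r K → List Γ} (hz : Shows e z m) (hz' : Shows e z' m')
    (hn : (z .input).length = n) (h : m' < m) : ClockLt z z' := by
  obtain ⟨v, hv, rfl⟩ := hz
  obtain ⟨v', hv', rfl⟩ := hz'
  obtain ⟨i, h1, h2⟩ := (he v' v).1 h
  refine ⟨fun i => ?_, i, fun j hj => ?_, ?_⟩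
  · have := (v' i).2
    rw [hv']
    omega
  · rw [hv, hv', h1 j hj]
  · rw [hv, hv']
    exact h2

/-- The strings that represent a configuration with a given clock. -/
def simTuple {Γ : Type} {r B : ℕ} (γ : Γ) (w : List Γ) (ρ : Fin r → List Γ) (v : Fin K → Fin B)
    (line flag : List Γ) : Track r K → List Γ
  | .input => w
  | .reg i => ρ i
  | .clock i => List.replicate (v i) γ
  | .line => line
  | .flag => flag

theorem shows_simTuple {Γ : Type} {r B m : ℕ} {e : (Fin K → Fin B) ≃ Fin (B ^ K)}
    (hm : m < B ^ K) (γ : Γ) (w : List Γ) (ρ : Fin r → List Γ) (line flag : List Γ) :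
    Shows e (simTuple γ w ρ (e.symm ⟨m, hm⟩) line flag) m :=
  ⟨e.symm ⟨m, hm⟩, fun _ => by simp [simTuple], by simp⟩

/-- The final clock value `m` is prescribed and generalized in the induction: one step earlier the
clock shows `m + 1`, so the setting step guesses `s + m`. -/
theorem exists_simSteps {γ : M.Γ} {x : List A}
    {e : (Fin K → Fin (x.length + 2)) ≃ Fin ((x.length + 2) ^ K)}
    (he : ∀ v w, e v < e w ↔ ∃ i, (∀ j < i, v j = w j) ∧ v i < w i)
    {s : ℕ} {c : M.Cfg} (h : StepsTo (M.Step x) s M.init c) (m : ℕ)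
    (hm : s + m < (x.length + 2) ^ K) :
    ∃ z, StepsTo (SimStep γ) (s + 1) (singleTuple .input (x.map M.incl)) z ∧
      Holds γ z c.line c.reg ∧ z .input = x.map M.incl ∧ Shows e z m := by
  generalize hc₀ : M.init = c₀ at h
  induction h generalizing m with
  | zero =>
    subst hc₀
    rw [zero_add] at hm
    refine ⟨simTuple γ (x.map M.incl) (fun _ => []) (e.symm ⟨m, hm⟩) [γ] [], (StepsTo.zero _).succ
      ⟨?_, singleTuple_of_ne (by simp) _, .inl ⟨singleTuple_of_ne (by simp) _, fun i => ?_, ?_⟩⟩,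
      ?_, rfl, shows_simTuple hm _ _ _ _ _⟩
    · exact (singleTuple_self _ _).symm
    · have := (e.symm ⟨m, hm⟩ i).2
      simp only [simTuple, List.length_replicate, singleTuple_self, List.length_map]
      omega
    · exact ⟨rfl, rfl, rfl⟩
    · exact ⟨rfl, rfl, rfl⟩
  | @succ s _ c c' h hr ih =>
    obtain ⟨z, h1, h2, h3, h4⟩ := ih (m + 1) (by omega) hc₀
    obtain ⟨I, hI, hp⟩ := hr
    obtain ⟨hl, hI⟩ := List.getElem?_eq_some_iff.1 hI
    have hm' : m < (x.length + 2) ^ K := by omega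
    set z' : Track M.numReg K → List M.Γ := simTuple γ (x.map M.incl) c'.reg (e.symm ⟨m, hm'⟩)
      (List.replicate (c'.line + 1) γ) [] with hz'
    have hsh : Shows e z' m := shows_simTuple hm' _ _ _ _ _
    have hh : Holds γ z' c'.line c'.reg := ⟨rfl, rfl, rfl⟩
    refine ⟨z', h1.succ ⟨h3.symm, h2.2.2, .inr ⟨⟨c.line, hl⟩, h2.2.1,
      clockLt_of_shows he h4 hsh (by simp [h3]) (Nat.lt_succ_self m), ?_⟩⟩, hh, rfl, hsh⟩
    exact (simPerform_iff h3 h2.1 _).2 (.inl ⟨c', hI ▸ hp, hh⟩)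

/-- Once the clock is set, elapsed steps plus clock value never exceed `(n + 2) ^ K`, which bounds
every path, accepting or not. A raised flag blocks all further steps; in particular, the empty line
track cannot cause a second initialization. -/
theorem simSteps_inv {γ : M.Γ} {x : List A}
    {e : (Fin K → Fin (x.length + 2)) ≃ Fin ((x.length + 2) ^ K)}
    (he : ∀ v w, e v < e w ↔ ∃ i, (∀ j < i, v j = w j) ∧ v i < w i)
    {s : ℕ} {z : Track M.numReg K → List M.Γ}
    (h : StepsTo (SimStep γ) s (singleTuple .input (x.map M.incl)) z) :
    (s = 0 ∧ z = singleTuple .input (x.map M.incl)) ∨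
      (z .input = x.map M.incl ∧ (∃ m, Shows e z m ∧ s + m ≤ (x.length + 2) ^ K) ∧
        ((∃ s' c, StepsTo (M.Step x) s' M.init c ∧ Holds γ z c.line c.reg) ∨
          (z .flag ≠ [] ∧ ∃ t, M.AcceptsIn x t))) := by
  generalize hz₀ : singleTuple (Track.input : Track M.numReg K) (x.map M.incl) = z₀ at h
  induction h with
  | zero => exact .inl ⟨rfl, rfl⟩
  | @succ s _ z z' h hr ih =>
    right
    obtain ⟨hin, hflag, hr⟩ := hr
    rcases ih hz₀ with ⟨rfl, rfl⟩ | ⟨hin', ⟨m, hm, hsm⟩, ih⟩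
    · rw [← hz₀] at hin hr
      rw [singleTuple_self] at hin hr
      rcases hr with ⟨-, hcl, hh⟩ | ⟨l, hl, -⟩
      · obtain ⟨m, hm, hsh⟩ := exists_shows e (z := z') fun i => by simpa using hcl i
        exact ⟨hin, ⟨m, hsh, by omega⟩, .inl ⟨0, M.init, .zero _, hh⟩⟩
      · rw [singleTuple_of_ne (by simp)] at hl
        simp at hl
    · rcases ih with ⟨s', c, hs', hh⟩ | ⟨h, -⟩
      · rcases hr with ⟨hl, -⟩ | ⟨l, hl, hcl, hp⟩
        · rw [hh.2.1] at hl
          simp at hl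
        · have hlc : (l : ℕ) = c.line := by
            simpa using congrArg List.length (hl.symm.trans hh.2.1)
          obtain ⟨m', hm', hsh⟩ := hm.of_clockLt he (by simp [hin']) hcl
          refine ⟨hin.trans hin', ⟨m', hsh, by omega⟩, ?_⟩
          have hI : M.program[c.line]? = some M.program[l] := by
            rw [← hlc]
            simp
          rw [hlc, simPerform_iff hin' hh.1] at hp
          rcases hp with ⟨c', hc', hh'⟩ | ⟨hacc, -, -, hf⟩
          · exact .inl ⟨_, c', hs'.succ ⟨_, hI, hc'⟩, hh'⟩
          · exact .inr ⟨by simp [hf], _, s', c, rfl, hs', by rw [hI, hacc]⟩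
      · exact absurd hflag h

end Simulation

/-- Every language over an empty alphabet is in `NP`. -/
theorem mem_NP_of_isEmpty {A : Type*} [IsEmpty A] (L : Language A) : L ∈ NP A := by
  classical
  let N : NTM A :=
    { Γ := Unit
      finiteΓ := inferInstance
      blank := ()
      incl := ⟨fun _ => (), fun a => isEmptyElim a⟩
      incl_ne_blank := fun a => isEmptyElim a
      Q := Bool
      finiteQ := inferInstance
      -- The empty word is the only input, so the start state can be the right answer.
      start := decide ([] ∈ L)
      accept := true
      reject := false
      accept_ne_reject := by simp
      δ := fun _ _ => ∅ }
  have hstep : ∀ {t x c}, StepsTo N.Step t (N.init x) c → t = 0 ∧ c = N.init x := by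
    intro t x c h
    cases h with
    | zero => exact ⟨rfl, rfl⟩
    | succ _ h =>
      obtain ⟨-, -, _, _, _, h, -⟩ := h
      exact h.elim
  refine Set.mem_iUnion.2 ⟨0, N, fun x => ?_, fun _ => 0, isBigO_pow_of_le (C := 0) (by simp),
    fun x t c h => (hstep h).1.le⟩
  rw [Subsingleton.elim x []]
  constructor
  · intro h
    exact ⟨0, _, .zero _, decide_eq_true h⟩
  · rintro ⟨t, c, h, hc⟩
    rw [(hstep h).2] at hc
    exact of_decide_eq_true hc

theorem BNALPoly_subset_NP (A : Type*) : BNALPoly A ⊆ NP A := by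
  intro L hL
  obtain ⟨k, M, hM, hL, g, hg, hbound⟩ := Set.mem_iUnion.1 hL
  have := M.finiteΓ
  -- Line numbers, clock digits and the flag are written in unary with a letter `γ`, so an empty
  -- machine alphabet is treated separately.
  rcases isEmpty_or_nonempty M.Γ with hΓ | ⟨⟨γ⟩⟩
  · have : IsEmpty A := M.incl.toFun.isEmpty
    exact mem_NP_of_isEmpty L
  obtain ⟨C, hC⟩ := exists_le_of_isBigO_pow hg
  -- The base is at least `2`, so `C < 2 ^ C` lets `C` extra digits absorb the constant factor.
  have hlt : ∀ n, g n < (n + 2) ^ (C + k) := fun n => by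
    calc g n ≤ C * (n + 1) ^ k := hC n
      _ ≤ C * (n + 2) ^ k := by gcongr; omega
      _ < 2 ^ C * (n + 2) ^ k := by
        have := Nat.lt_two_pow_self (n := C)
        gcongr
      _ ≤ (n + 2) ^ C * (n + 2) ^ k := by gcongr; omega
      _ = (n + 2) ^ (C + k) := (pow_add _ _ _).symm
  set K := C + k
  obtain ⟨c, hc⟩ := exists_simStep_length_le (K := K) hM γ
  -- A nonempty flag is visible in the first column, the one inspected for acceptance.
  refine mem_NP_of_iterate (J := Track M.numReg K) (incl := M.incl) (inp := .input)
    (acc := {a | a .flag ≠ none}) (isAutomatic_simStep γ) (c := c) (fun z z' h => hc z z' h)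
    (fun z z' h => SimStep.col_ne_blankCol (γ := γ) h) (C := 2 ^ K) (k := K) (fun x s z h => ?_)
    fun x => ?_
  · obtain ⟨e, he⟩ := exists_lex_equiv K (x.length + 2)
    have hle : s ≤ (x.length + 2) ^ K := by
      rcases simSteps_inv (γ := γ) he h with ⟨rfl, -⟩ | ⟨-, ⟨m, -, hm⟩, -⟩ <;> omega
    refine hle.trans ?_
    rw [← mul_pow]
    gcongr
    omega
  · obtain ⟨e, he⟩ := exists_lex_equiv K (x.length + 2)
    rw [hL]
    constructor
    · rintro ⟨t, ht⟩
      have htg := (hbound x t ht).trans_lt (hlt x.length)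
      obtain ⟨s, cf, rfl, hs, hacc⟩ := ht
      -- The clock is left at `1`, so that it can drop to `0` in the step that raises the flag.
      obtain ⟨z, h1, h2, h3, h4⟩ := exists_simSteps (γ := γ) he hs 1 htg
      obtain ⟨hl, hI⟩ := List.getElem?_eq_some_iff.1 hacc
      have h0 : 0 < (x.length + 2) ^ K := by positivity
      refine ⟨s + 1, simTuple γ (x.map M.incl) cf.reg (e.symm ⟨0, h0⟩) [] [γ], h1.succ ?_,
        by simp [col, simTuple]⟩
      refine ⟨h3.symm, h2.2.2, .inr ⟨⟨cf.line, hl⟩, h2.2.1, clockLt_of_shows he h4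
        (shows_simTuple h0 _ _ _ _ _) (by simp [h3]) one_pos, ?_⟩⟩
      exact (simPerform_iff h3 h2.1 _).2 (.inr ⟨hI, rfl, rfl, rfl⟩)
    · rintro ⟨s, z, h, hz⟩
      rcases simSteps_inv (γ := γ) he h with ⟨h0, -⟩ | ⟨-, -, ⟨s', cf, -, hh⟩ | ⟨-, h⟩⟩
      · omega
      · exact absurd (by simp [col, hh.2.2]) hz
      · exact h

/-! ### Turing machines are simulated by register machines -/

section Encoding

instance finite_move : Finite Move :=
  Finite.of_surjective (fun i : Fin 3 => match i with
      | 0 => Move.left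
      | 1 => .right
      | 2 => .stay)
    (by
      rintro (_ | _ | _)
      · exact ⟨0, rfl⟩
      · exact ⟨1, rfl⟩
      · exact ⟨2, rfl⟩)

variable {A : Type*} {N : NTM A}

/-- The first `m` cells of the tape, as a string in which the scanned cell is marked with the
state. -/
def encode (m : ℕ) (c : N.Cfg) : List (Option N.Q × N.Γ) :=
  (List.range m).map fun i => (if i = c.head then some c.state else none, c.tape i)

/-- The first `m` cells contain the head and all cells that are not empty. -/
def Within (m : ℕ) (c : N.Cfg) : Prop := c.head < m ∧ ∀ i, m ≤ i → c.tape i = N.blank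

/-- The cell is scanned. -/
def Scanned (o : Option (Option N.Q × N.Γ)) : Prop := ∃ q s, o = some (some q, s)

/-- The symbol in a cell, where the cells behind the string are empty. -/
def symbol (o : Option (Option N.Q × N.Γ)) : N.Γ := (o.map Prod.snd).getD N.blank

/-- The mark `h` is `q` if `p` holds, and there is no mark otherwise. -/
def Marked {Q : Type} (q : Q) (p : Prop) (h : Option Q) : Prop :=
  (p → h = some q) ∧ (¬ p → h = none)

theorem getElem?_encode (m : ℕ) (c : N.Cfg) (i : ℕ) : (encode m c)[i]? =
    if i < m then some (if i = c.head then some c.state else none, c.tape i) else none := by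
  by_cases h : i < m
  · simp [encode, h]
  · simp [encode, h]

theorem marked_iff {Q : Type} {q : Q} {p : Prop} [Decidable p] {h : Option Q} :
    Marked q p h ↔ h = if p then some q else none := by
  by_cases hp : p <;> simp [Marked, hp]

theorem scanned_encode {m : ℕ} {c : N.Cfg} (hc : Within m c) (i : ℕ) :
    Scanned (encode m c)[i]? ↔ i = c.head := by
  rw [getElem?_encode]
  constructor
  · rintro ⟨q, s, h⟩
    by_contra hi
    split_ifs at h
    simp at h
  · rintro rfl
    exact ⟨c.state, c.tape c.head, by simp [hc.1]⟩

theorem symbol_encode {m : ℕ} {c : N.Cfg} (hc : Within m c) (i : ℕ) :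
    symbol (encode m c)[i]? = c.tape i := by
  rw [getElem?_encode]
  split_ifs with h
  · rfl
  · rfl
  · exact (hc.2 i (not_lt.1 h)).symm

/-- The condition that a step with move `m` to state `q` puts on the marks of an old cell, the new
one, and their right neighbours. -/
def MoveCond (q : N.Q) (first : Bool) (o n o' n' : Option (Option N.Q × N.Γ)) : Move → Prop
  | .left => ∀ h y, n = some (h, y) → Marked q (Scanned o' ∨ (first = true ∧ Scanned o)) h
  | .right => (first = true → ∀ h y, n = some (h, y) → h = none) ∧
      ∀ h y, n' = some (h, y) → Marked q (Scanned o) h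
  | .stay => ∀ h y, n = some (h, y) → Marked q (Scanned o) h

/-- The condition that an action puts on an old cell, the new one, and their right neighbours. -/
def StepCond (q : N.Q) (s : N.Γ) (q' : N.Q) (b : N.Γ) (m : Move) (first : Bool)
    (o n o' n' : Option (Option N.Q × N.Γ)) : Prop :=
  ((first = true → n ≠ none) ∧ (n' = none ↔ o = none)) ∧
    (Scanned o → o = some (some q, s)) ∧
    (∀ h y, n = some (h, y) → (Scanned o → y = b) ∧ (¬ Scanned o → y = symbol o)) ∧
    MoveCond q' first o n o' n' m

/-- The relation between the strings for a configuration and the next one. -/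
def StepRel (N : NTM A) (w w' : List (Option N.Q × N.Γ)) : Prop :=
  ∃ q s q' b m, (q ≠ N.accept ∧ q ≠ N.reject ∧ (q', b, m) ∈ N.δ q s) ∧
    ∀ i : ℕ, StepCond q s q' b m (i == 0) w[i]? w'[i]? w[i + 1]? w'[i + 1]?

/-- The condition that the initial marking puts on an old cell, the new one, and their right
neighbours. -/
def InitCond (first : Bool) (o n o' n' : Option (Option N.Q × N.Γ)) : Prop :=
  (first = true → n = some (some N.start, symbol o)) ∧ (o = none → n' = none) ∧
    (o ≠ none → n' = some (none, symbol o'))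

/-- The relation between the input and the string for the initial configuration. -/
def InitRel (N : NTM A) (w w' : List (Option N.Q × N.Γ)) : Prop :=
  ∀ i : ℕ, InitCond (i == 0) w[i]? w'[i]? w[i + 1]? w'[i + 1]?

/-- The equivalence at `w.length` and at `w'.length - 1` gives the two inequalities; the condition
at `0` makes that subtraction genuine. -/
theorem length_eq_succ_of_getElem? {α : Type*} {w w' : List α}
    (h : ∀ i : ℕ, ((i == 0) = true → w'[i]? ≠ none) ∧ (w'[i + 1]? = none ↔ w[i]? = none)) :
    w'.length = w.length + 1 := by
  have h0 := (h 0).1 rfl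
  have h1 := (h w.length).2
  have h2 := (h (w'.length - 1)).2
  simp only [ne_eq, List.getElem?_eq_none_iff] at h0 h1 h2
  omega

theorem StepRel.length_eq {w w' : List (Option N.Q × N.Γ)} (h : StepRel N w w') :
    w'.length = w.length + 1 := by
  obtain ⟨_, _, _, _, _, -, h⟩ := h
  exact length_eq_succ_of_getElem? fun i => (h i).1

theorem InitRel.length_eq {w w' : List (Option N.Q × N.Γ)} (h : InitRel N w w') :
    w'.length = w.length + 1 := by
  refine length_eq_succ_of_getElem? fun i => ⟨fun hi => ?_, fun hi => ?_, (h i).2.1⟩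
  · rw [(h i).1 hi]
    simp
  · by_contra h'
    rw [(h i).2.2 h'] at hi
    cases hi

theorem initRel_iff (x : List A) (w : List (Option N.Q × N.Γ)) :
    InitRel N (x.map fun a => (none, N.incl a)) w ↔ w = encode (x.length + 1) (N.init x) := by
  have hsym : ∀ i : ℕ, symbol (N := N) (x.map fun a => (none, N.incl a))[i]? =
      (N.init x).tape i := fun i => by
    simp only [symbol, NTM.init, List.getElem?_map, List.getD_eq_getElem?_getD]
    cases x[i]? <;> rfl
  constructor
  · intro h
    refine List.ext_getElem? fun i => ?_
    rw [getElem?_encode]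
    rcases i with _ | i
    · rw [(h 0).1 rfl, hsym]
      simp [NTM.init]
    · split_ifs with hi hi'
      · exact absurd hi' (Nat.succ_ne_zero i)
      · rw [(h i).2.2 (by simpa using hi), hsym]
      · exact (h i).2.1 (by simpa using hi)
  · rintro rfl i
    refine ⟨fun hi => ?_, fun hi => ?_, fun hi => ?_⟩
    · obtain rfl : i = 0 := by simpa using hi
      rw [getElem?_encode, hsym]
      simp [NTM.init]
    · rw [getElem?_encode, if_neg]
      simpa using hi
    · rw [getElem?_encode, if_pos (by simpa using hi), hsym, if_neg]
      exact Nat.succ_ne_zero i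

/-- The conditions determine every new cell: its symbol from the old cell, and its mark from the old
cell at the same place or at a neighbouring one. The extra cell leaves room for a move to the right.
-/
theorem stepRel_encode_iff {m : ℕ} {c : N.Cfg} (hc : Within m c)
    (w : List (Option N.Q × N.Γ)) :
    StepRel N (encode m c) w ↔ ∃ c', N.Step c c' ∧ w = encode (m + 1) c' := by
  have hnone : ∀ i, (encode m c)[i]? = none ↔ m ≤ i := fun i => by simp [encode]
  have hhead : (encode m c)[c.head]? = some (some c.state, c.tape c.head) := by
    simp [getElem?_encode, hc.1]
  constructor
  · intro hw
    have hlen : w.length = m + 1 := by simpa [encode] using hw.length_eq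
    obtain ⟨q, s, q', b, mv, ⟨hq, hq', hδ⟩, h⟩ := hw
    -- The condition at the scanned cell identifies the guessed state and symbol with the actual
    -- ones.
    have h1 := (h c.head).2.1 ((scanned_encode hc _).2 rfl)
    rw [hhead] at h1
    obtain ⟨rfl, rfl⟩ : c.state = q ∧ c.tape c.head = s := by simpa using h1
    refine ⟨_, ⟨hq, hq', q', b, mv, hδ, rfl⟩, List.ext_getElem? fun i => ?_⟩
    rw [getElem?_encode]
    split_ifs with hi hi'
    all_goals try exact List.getElem?_eq_none (by omega)
    all_goals
      obtain ⟨⟨k, y⟩, hky⟩ : ∃ p, w[i]? = some p := ⟨_, List.getElem?_eq_getElem (by omega)⟩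
      rw [hky]
      have hy := (h i).2.2.1 k y hky
      rw [scanned_encode hc, symbol_encode hc] at hy
      have hy' : y = Function.update c.tape c.head b i := by
        by_cases hih : i = c.head
        · rw [hy.1 hih, hih, Function.update_self]
        · rw [hy.2 hih, Function.update_of_ne hih]
      have hk : k = if i = NTM.moveHead c.head mv then some q' else none := by
        cases mv with
        | left =>
          have := (h i).2.2.2 k y hky
          rw [scanned_encode hc, scanned_encode hc, marked_iff] at this
          rw [this]
          congr 1
          -- The truncated subtraction at the left end corresponds to the alternative for a scanned
          -- first cell.
          simp only [NTM.moveHead, beq_iff_eq, eq_iff_iff]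
          omega
        | right =>
          -- A move to the right marks a right neighbour, so the first cell is governed by its own
          -- clause.
          rcases i with _ | i
          · rw [(h 0).2.2.2.1 rfl k y hky, if_neg]
            exact (Nat.succ_ne_zero _).symm
          · have := (h i).2.2.2.2 k y hky
            rw [scanned_encode hc, marked_iff] at this
            rw [this]
            simp [NTM.moveHead]
        | stay =>
          have := (h i).2.2.2 k y hky
          rw [scanned_encode hc, marked_iff] at this
          exact this
      rw [hy', hk]
      simp [hi']
  · rintro ⟨_, ⟨hq, hq', q', b, mv, hδ, rfl⟩, rfl⟩
    refine ⟨_, _, q', b, mv, ⟨hq, hq', hδ⟩, fun i => ⟨⟨fun hi => ?_, ?_⟩, fun hi => ?_,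
      fun k y hk => ?_, ?_⟩⟩
    · obtain rfl : i = 0 := by simpa using hi
      simp [getElem?_encode]
    · rw [hnone]
      simp [encode]
    · rw [(scanned_encode hc i).1 hi, hhead]
    · rw [getElem?_encode] at hk
      split_ifs at hk <;> (
        obtain ⟨-, rfl⟩ := Prod.mk.inj (Option.some.inj hk)
        rw [scanned_encode hc, symbol_encode hc]
        exact ⟨fun e => by simp [e], fun e => by simp [e]⟩)
    · have key : ∀ i k y, (encode (m + 1) (⟨q', NTM.moveHead c.head mv,
          Function.update c.tape c.head b⟩ : N.Cfg))[i]? = some (k, y) →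
          k = if i = NTM.moveHead c.head mv then some q' else none := fun i k y hk => by
        rw [getElem?_encode] at hk
        split_ifs at hk with h1 h2
        · rw [if_pos h2]
          exact (Prod.mk.inj (Option.some.inj hk)).1.symm
        · rw [if_neg h2]
          exact (Prod.mk.inj (Option.some.inj hk)).1.symm
      cases mv with
      | left =>
        intro k y hk
        rw [key i k y hk, scanned_encode hc, scanned_encode hc, marked_iff]
        congr 1
        simp only [NTM.moveHead, beq_iff_eq, eq_iff_iff]
        omega
      | right =>
        refine ⟨fun hi k y hk => ?_, fun k y hk => ?_⟩
        · obtain rfl : i = 0 := by simpa using hi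
          rw [key 0 k y hk, if_neg]
          exact (Nat.succ_ne_zero _).symm
        · rw [key (i + 1) k y hk, scanned_encode hc, marked_iff]
          simp [NTM.moveHead]
      | stay =>
        intro k y hk
        rw [key i k y hk, scanned_encode hc, marked_iff]
        rfl

theorem within_init (x : List A) : Within (x.length + 1) (N.init x) := by
  refine ⟨Nat.succ_pos _, fun i hi => ?_⟩
  simp only [NTM.init]
  rw [List.getD_eq_default]
  simp
  omega

theorem Within.step {m : ℕ} {c c' : N.Cfg} (hc : Within m c) (h : N.Step c c') :
    Within (m + 1) c' := by
  obtain ⟨-, -, q, a, mv, -, rfl⟩ := h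
  obtain ⟨h1, h2⟩ := hc
  refine ⟨?_, fun i hi => ?_⟩
  · cases mv <;> simp only [NTM.moveHead] <;> omega
  · simp only
    rw [Function.update_of_ne (by omega)]
    exact h2 i (by omega)

theorem exists_accept_encode_iff {m : ℕ} {c : N.Cfg} (hc : Within m c) :
    (∃ (i : ℕ) (s : N.Γ), (encode m c)[i]? = some (some N.accept, s)) ↔ c.state = N.accept := by
  constructor
  · rintro ⟨i, s, h⟩
    rw [(scanned_encode hc i).1 ⟨_, _, h⟩, getElem?_encode] at h
    simp at h
    exact h.2.1
  · intro h
    exact ⟨c.head, c.tape c.head, by simp [getElem?_encode, hc.1, h]⟩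

/-! #### The register machine -/

section Automatic

variable [Finite N.Q] [Finite N.Γ]

theorem isAutomatic_initRel :
    IsAutomatic (graph fun (x : Fin 1 → List (Option N.Q × N.Γ)) y => InitRel N (x 0) y) :=
  (Recognizable.of_local (ι := Option (Fin 1)) (Γ := Option N.Q × N.Γ)
    (Q := fun b c d => InitCond b (c (some 0)) (c none) (d (some 0)) (d none))
    (by simp [InitCond, blankCol])).isAutomatic

theorem isAutomatic_stepRel :
    IsAutomatic (graph fun (x : Fin 1 → List (Option N.Q × N.Γ)) y => StepRel N (x 0) y) :=
  Recognizable.isAutomatic <| .exists_finite fun q => .exists_finite fun s =>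
    .exists_finite fun q' => .exists_finite fun b => .exists_finite fun m =>
      .and (.const _) (Recognizable.of_local (ι := Option (Fin 1)) (Γ := Option N.Q × N.Γ)
        (Q := fun f c d => StepCond q s q' b m f (c (some 0)) (c none) (d (some 0)) (d none))
        (by cases m <;> simp [StepCond, MoveCond, blankCol, Scanned]))

theorem isAutomatic_exists_accept :
    IsAutomatic {x : Fin 1 → List (Option N.Q × N.Γ) |
      ∃ (i : ℕ) (s : N.Γ), (x 0)[i]? = some (some N.accept, s)} :=
  ((Recognizable.of_forall_col (ι := Fin 1) (Γ := Option N.Q × N.Γ)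
    (Q := fun c => ∀ s, c 0 ≠ some (some N.accept, s)) (by simp [blankCol])).not.congr
      fun z => by simp [col]).isAutomatic

end Automatic

/-- The register machine that simulates a Turing machine: it marks the first cell of the input with
the initial state, and then performs steps until the state is accepting. -/
def simARM (N : NTM A) : ARM A where
  Γ := Option N.Q × N.Γ
  finiteΓ := by
    have := N.finiteQ
    have := N.finiteΓ
    infer_instance
  incl := ⟨fun a => (none, N.incl a), fun a b h => N.incl.injective (congrArg Prod.snd h)⟩
  numReg := 1
  Op := Bool
  finiteOp := inferInstance
  arity _ := 1
  op b x y := match b with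
    | false => InitRel N (x 0) y
    | true => StepRel N (x 0) y
  op_automatic b := by
    have := N.finiteQ
    have := N.finiteΓ
    cases b
    · exact isAutomatic_initRel
    · exact isAutomatic_stepRel
  Test := Unit
  finiteTest := inferInstance
  testArity _ := 1
  test _ := {x | ∃ (i : ℕ) (s : N.Γ), (x 0)[i]? = some (some N.accept, s)}
  test_automatic _ := by
    have := N.finiteQ
    have := N.finiteΓ
    exact isAutomatic_exists_accept
  program := [.read 0, .apply 0 false fun _ => 0, .ifGoto () (fun _ => 0) 5,
    .apply 0 true fun _ => 0, .goto 2, .haltAccept]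

theorem isNARM_simARM : (simARM N).IsNARM := by
  intro b
  refine ⟨1, fun x y h => ?_⟩
  have hx : maxLen x = (x (0 : Fin 1)).length :=
    le_antisymm (maxLen_le_iff.2 fun j => by rw [Subsingleton.elim (α := Fin 1) j 0])
      (length_le_maxLen x (0 : Fin 1))
  have hlen : y.length = (x (0 : Fin 1)).length + 1 := by
    cases b
    · exact InitRel.length_eq h
    · exact StepRel.length_eq h
  omega

/-- The configuration of the simulating machine in a given line. -/
def simCfg (l m : ℕ) (c : N.Cfg) : (simARM N).Cfg := ⟨l, fun _ => encode m c⟩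

theorem update_simReg (ρ : Fin 1 → List (Option N.Q × N.Γ)) (w : List (Option N.Q × N.Γ)) :
    Function.update ρ 0 w = fun _ => w := by
  funext i
  rw [Subsingleton.elim i 0, Function.update_self]

/-- The configurations that the simulating machine reaches in `t` steps. -/
inductive SimInv (N : NTM A) (x : List A) : ℕ → (simARM N).Cfg → Prop
  | init : SimInv N x 0 (simARM N).init
  | read : SimInv N x 1 ⟨1, fun _ => x.map (simARM N).incl⟩
  | test (r m : ℕ) (c : N.Cfg) (h : StepsTo N.Step r (N.init x) c) (hc : Within m c) :
      SimInv N x (3 * r + 2) (simCfg 2 m c)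
  | step (r m : ℕ) (c : N.Cfg) (h : StepsTo N.Step r (N.init x) c) (hc : Within m c) :
      SimInv N x (3 * r + 3) (simCfg 3 m c)
  | goto (r m : ℕ) (c : N.Cfg) (h : StepsTo N.Step (r + 1) (N.init x) c) (hc : Within m c) :
      SimInv N x (3 * r + 4) (simCfg 4 m c)
  | accept (r m : ℕ) (c : N.Cfg) (h : StepsTo N.Step r (N.init x) c) (hc : c.state = N.accept) :
      SimInv N x (3 * r + 3) (simCfg 5 m c)

theorem SimInv.of_update {x : List A} {t l : ℕ} {ρ : Fin 1 → List (Option N.Q × N.Γ)}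
    {w : List (Option N.Q × N.Γ)} (h : SimInv N x t ⟨l, fun _ => w⟩) :
    SimInv N x t ⟨l, Function.update ρ (0 : Fin 1) w⟩ := by
  have e : (⟨l, Function.update ρ (0 : Fin 1) w⟩ : (simARM N).Cfg) = ⟨l, fun _ => w⟩ :=
    congrArg _ (update_simReg ρ w)
  exact e.symm ▸ h

/-- Test, step and jump account for three instructions per step of the Turing machine, after two for
reading and marking the input. -/
theorem SimInv.succ {x : List A} {t : ℕ} {C C' : (simARM N).Cfg} (hC : SimInv N x t C)
    (h : (simARM N).Step x C C') : SimInv N x (t + 1) C' := by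
  obtain ⟨I, hI, h⟩ := h
  cases hC with
  | init =>
    cases hI
    obtain rfl := h
    exact SimInv.of_update .read
  | read =>
    cases hI
    obtain ⟨y, hy, rfl⟩ := h
    obtain rfl := (initRel_iff x y).1 hy
    exact SimInv.of_update (.test 0 _ _ (.zero (N.init x)) (within_init x))
  | test r m c hr hc =>
    cases hI
    rcases h with ⟨ht, rfl⟩ | ⟨-, rfl⟩
    · exact .accept r m c hr ((exists_accept_encode_iff hc).1 ht)
    · exact .step r m c hr hc
  | step r m c hr hc =>
    cases hI
    obtain ⟨y, hy, rfl⟩ := h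
    obtain ⟨c', hc', rfl⟩ := (stepRel_encode_iff hc y).1 hy
    exact SimInv.of_update (.goto r (m + 1) c' (hr.succ hc') (hc.step hc'))
  | goto r m c hr hc =>
    cases hI
    obtain rfl := h
    exact .test (r + 1) m c hr hc
  | accept =>
    cases hI
    exact h.elim

theorem SimInv.of_stepsTo {x : List A} {t : ℕ} {C : (simARM N).Cfg}
    (h : StepsTo ((simARM N).Step x) t (simARM N).init C) : SimInv N x t C := by
  generalize hC : (simARM N).init = C₀ at h
  induction h with
  | zero =>
    subst hC
    exact .init
  | succ _ hr ih => exact (ih hC).succ hr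

/-- A configuration with a successor is not accepting, so the test fails and the loop goes on. -/
theorem exists_stepsTo_simCfg {x : List A} {r : ℕ} {c : N.Cfg}
    (h : StepsTo N.Step r (N.init x) c) :
    ∃ m, Within m c ∧ StepsTo ((simARM N).Step x) (3 * r + 2) (simARM N).init (simCfg 2 m c) := by
  generalize hc₀ : N.init x = c₀ at h
  induction h with
  | zero =>
    subst hc₀
    refine ⟨x.length + 1, within_init x,
      ((StepsTo.zero _).succ (b := (simARM N).init)
        (c := ⟨1, fun _ => x.map (simARM N).incl⟩) ⟨.read (0 : Fin 1), rfl, ?_⟩).succ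
        ⟨.apply (0 : Fin 1) false fun _ => (0 : Fin 1), rfl, _, (initRel_iff x _).2 rfl, ?_⟩⟩
    · exact congrArg _ (update_simReg _ _).symm
    · exact congrArg _ (update_simReg _ _).symm
  | @succ r _ c c' h hr ih =>
    obtain ⟨m, hm, hs⟩ := ih hc₀
    refine ⟨m + 1, hm.step hr, ((hs.succ (c := simCfg 3 m c)
      ⟨.ifGoto () (fun _ => (0 : Fin 1)) 5, rfl, .inr ⟨fun hacc => ?_, rfl⟩⟩).succ
      (c := simCfg 4 (m + 1) c') ⟨.apply (0 : Fin 1) true fun _ => (0 : Fin 1), rfl, _,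
        (stepRel_encode_iff hm _).2 ⟨c', hr, rfl⟩, ?_⟩).succ ⟨.goto 2, rfl, rfl⟩⟩
    · exact hr.1 ((exists_accept_encode_iff hm).1 hacc)
    · exact congrArg _ (update_simReg _ _).symm

end Encoding

theorem NP_subset_BNALPoly (A : Type*) : NP A ⊆ BNALPoly A := by
  intro L hL
  obtain ⟨k, N, hL, g, hg, hbound⟩ := Set.mem_iUnion.1 hL
  obtain ⟨C, hC⟩ := exists_le_of_isBigO_pow hg
  -- Besides the `3 * r + 2` steps before the last test, there are this test and `halt_accept`.
  -- Hence the bound on all paths of `N` bounds every accepting path.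
  have hacc : ∀ x t, (simARM N).AcceptsIn x t →
      ∃ r c, t = 3 * r + 4 ∧ StepsTo N.Step r (N.init x) c ∧ c.state = N.accept := by
    rintro x _ ⟨s, c, rfl, hs, hc⟩
    cases SimInv.of_stepsTo hs with
    | init | read | test | step | goto => cases hc
    | accept r m c h hstate => exact ⟨r, c, rfl, h, hstate⟩
  refine Set.mem_iUnion.2 ⟨k, simARM N, isNARM_simARM, fun x => ?_, fun n => 3 * g n + 4,
    isBigO_pow_of_le (C := 3 * C + 4) fun n => ?_, fun x t h => ?_⟩
  · rw [hL]
    constructor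
    · rintro ⟨r, c, h, hc⟩
      obtain ⟨m, hm, hs⟩ := exists_stepsTo_simCfg h
      exact ⟨_, _, simCfg 5 m c, rfl, hs.succ ⟨.ifGoto () (fun _ => (0 : Fin 1)) 5, rfl,
        .inl ⟨(exists_accept_encode_iff hm).2 hc, rfl⟩⟩, rfl⟩
    · rintro ⟨t, h⟩
      obtain ⟨r, c, -, h, hc⟩ := hacc x t h
      exact ⟨r, c, h, hc⟩
  · have h1 := hC n
    have h2 : 1 ≤ (n + 1) ^ k := Nat.one_le_pow _ _ (by omega)
    rw [add_mul, mul_assoc]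
    omega
  · obtain ⟨r, c, rfl, h, -⟩ := hacc x t h
    have := hbound x r c h
    dsimp only
    omega

end AutReg

theorem mainTheorem4 (A : Type*) [Finite A] : AutReg.BNALPoly A = AutReg.NP A :=
  (AutReg.BNALPoly_subset_NP A).antisymm (AutReg.NP_subset_BNALPoly A)
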